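/- Let $n\ge 1$, let $\Omega\subset\mathbb R^n$ be a bounded $C^{1,1}$ domain (bounded, open, connected, nonempty, with $C^{1,1}$ boundary), let $\mathbf A$ be a nonempty finite set and $\mathbf B$ a nonempty compact metric space. Let $a^{ij}\in C(\overline\Omega)$ ($1\le i,j\le n$) satisfy, for some $\lambda>0$, $\sum_{i,j}a^{ij}(x)\xi_i\xi_j\ge\lambda\sum_i\xi_i^2$ for all $\xi\in\mathbb R^n$, $x\in\Omega$. Let $b^i$ ($1\le i\le n$), $c$, $f$ be real functions on $\Omega\times\mathbf A\times\mathbf B$ such that each $\phi\in\{b^1,\dots,b^n,c,f\}$ is (essentially) bounded (for some $K$ and a.e. $x\in\Omega$, $|\phi(x,\alpha,\beta)|\le K$ for all $\alpha,\beta$), Lebesgue measurable in $x$ for every $(\alpha,\beta)$, and continuous in $\beta$ for every $(x,\alpha)\in\Omega\times\mathbf A$; and let $c\ge 0$ on $\Omega\times\mathbf A\times\mathbf B$. For $(x,z,p)\in\Omega\times\mathbb R\times\mathbb R^n$ put (with summation over repeated indices) $$\ell(x,z,p,\alpha,\beta)=b^i(x,\alpha,\beta)p_i+c(x,\alpha,\beta)z-f(x,\alpha,\beta),\qquad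 G(x,z,p)=\max_{\alpha\in\mathbf A}\min_{\beta\in\mathbf B}\ell(x,z,p,\alpha,\beta),$$ and for $u\in H^2(\Omega)$ put $F(u)=-a^{ij}\partial_{ij}u+G(\cdot,u,\nabla u)$. Measurability on $\Omega$ below is with respect to the Lebesgue $\sigma$-algebra, and $u(x),\nabla u(x)$ denote pointwise values of any representatives of $u,\nabla u$. For Banach spaces $Y,Z$, a map $F:V\subset Y\to Z$ on an open set $V$ and a set-valued map $\partial^*F:V\rightrightarrows\mathcal L(Y,Z)$, say that $F$ is $\partial^*F$-semismooth in $V$ (and $\partial^*F$ is a generalized differential of $F$ in $V$) if for every $y\in V$ the set $\partial^*F(y)$ is nonempty, $F$ is continuous near $y$, and $$\sup_{M\in\partial^*F(y+s)}\|F(y+s)-F(y)-Ms\|_Z=o(\|s\|_Y)\quad\text{as }\|s\|_Y\to 0.$$ Then $F$ is a well-defined map $H^2(\Omega)\to L^2(\Omega)$, and the following hold. 1. For all measurable $\alpha:\Omega\to\mathbf A$, $\beta:\Omega\to\mathbf B$, the formula $L_{\alpha,\beta}=-a^{ij}\partial_{ij}+b^i(\cdot,\alpha(\cdot),\beta(\cdot))\partial_i+c(\cdot,\alpha(\cdot),\beta(\cdot))$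 defines an element of $\mathcal L(H^2(\Omega),L^2(\Omega))$. 2. $F$ is $\partial^*F$-semismooth in $H^2(\Omega)$, where $\partial^*F(u)$ is the set of all operators $L_{\alpha,\beta^u(\cdot,\alpha(\cdot))}$ such that $\beta^u:\Omega\times\mathbf A\to\mathbf B$ is jointly measurable with $\beta^u(x,\alpha')\in\arg\min_{\beta\in\mathbf B}\ell(x,u(x),\nabla u(x),\alpha',\beta)$ for all $(x,\alpha')\in\Omega\times\mathbf A$, and $\alpha:\Omega\to\mathbf A$ is measurable with $\alpha(x)\in\arg\max_{\alpha'\in\mathbf A}\min_{\beta\in\mathbf B}\ell(x,u(x),\nabla u(x),\alpha',\beta)$ for a.e. $x\in\Omega$. 3. $F$ is also semismooth in $H^2(\Omega)$ with respect to the generalized differential that assigns to $u$ the set of all operators $L_{\alpha^u,\beta^u}$ such that $\alpha^u:\Omega\to\mathbf A$ and $\beta^u:\Omega\to\mathbf B$ are measurable and, for all $x\in\Omega$, $\alpha^u(x)\in\arg\max_{\alpha\in\mathbf A}\min_{\beta\in\mathbf B}\ell(x,u(x),\nabla u(x),\alpha,\beta)$ and $\beta^u(x)\in\arg\min_{\beta\in\mathbf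 B}\ell(x,u(x),\nabla u(x),\alpha^u(x),\beta)$. For every $u\in H^2(\Omega)$ this set equals $\partial^*F(u)$. 4. For every $u\in H^2(\Omega)$ and every choice of representatives of $u$ and $\nabla u$, measurable controls as in 2 and as in 3 exist. -/

import Mathlib

open MeasureTheory Set Filter Topology
open scoped ContDiff ENNReal

noncomputable section

/-! ### Domains -/

/-- Bounded `C^{1,1}` domain: a bounded, open, connected (and nonempty) set which near each of its
boundary points is, for some unit direction `ν`, the strict epigraph in direction `ν` of a function
`γ` of the component orthogonal to `ν`, with `γ` continuously differentiable and `Dγ` Lipschitz. -/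
structure IsC11Domain {n : ℕ} (Ω : Set (EuclideanSpace ℝ (Fin n))) : Prop where
  isOpen : IsOpen Ω
  isConnected : IsConnected Ω
  isBounded : Bornology.IsBounded Ω
  boundary : ∀ x₀ ∈ frontier Ω,
    ∃ (ν : EuclideanSpace ℝ (Fin n)) (r : ℝ) (γ : EuclideanSpace ℝ (Fin n) → ℝ) (K : NNReal),
      ‖ν‖ = 1 ∧ 0 < r ∧ ContDiff ℝ 1 γ ∧ LipschitzWith K (fderiv ℝ γ) ∧
      ∀ y ∈ Metric.ball x₀ r, (y ∈ Ω ↔ γ (y - inner ℝ ν y • ν) < inner ℝ ν y)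

/-! ### The spaces `L²(Ω)` and `H²(Ω)` -/

/-- The Lebesgue space `L²(Ω)` of real functions. -/
abbrev L2 {n : ℕ} (Ω : Set (EuclideanSpace ℝ (Fin n))) : Type :=
  Lp ℝ 2 (volume.restrict Ω)

/-- The `i`-th partial derivative of `φ`. -/
def pderiv {n : ℕ} (i : Fin n) (φ : EuclideanSpace ℝ (Fin n) → ℝ)
    (x : EuclideanSpace ℝ (Fin n)) : ℝ :=
  fderiv ℝ φ x (EuclideanSpace.single i 1)

/-- `g ∈ L²(Ω)` is the weak `i`-th partial derivative of `u ∈ L²(Ω)` in `Ω`. -/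
def IsWeakPartial {n : ℕ} (Ω : Set (EuclideanSpace ℝ (Fin n))) (i : Fin n) (u g : L2 Ω) : Prop :=
  ∀ φ : EuclideanSpace ℝ (Fin n) → ℝ, ContDiff ℝ ∞ φ → HasCompactSupport φ → tsupport φ ⊆ Ω →
    ∫ x in Ω, u x * pderiv i φ x = - ∫ x in Ω, g x * φ x

/-- Indices of the derivatives of order at most two: the function itself, the first order
derivatives `∂ᵢ`, and the second order derivatives `∂ᵢⱼ`. -/
abbrev JetIndex (n : ℕ) : Type := Unit ⊕ (Fin n ⊕ (Fin n × Fin n))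

/-- The `ℓ²`-product of one copy of `L²(Ω)` for every derivative of order at most two. -/
abbrev Jet {n : ℕ} (Ω : Set (EuclideanSpace ℝ (Fin n))) : Type :=
  PiLp 2 (fun _ : JetIndex n => L2 Ω)

section testing

variable {n : ℕ} {Ω : Set (EuclideanSpace ℝ (Fin n))}

theorem memLp_test {ψ : EuclideanSpace ℝ (Fin n) → ℝ} (hψ : Continuous ψ)
    (hs : HasCompactSupport ψ) : MemLp ψ 2 (volume.restrict Ω) :=
  (hψ.memLp_of_hasCompactSupport hs).restrict Ω

theorem integrable_mul_test (u : L2 Ω) {ψ : EuclideanSpace ℝ (Fin n) → ℝ} (hψ : Continuous ψ)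
    (hs : HasCompactSupport ψ) : Integrable (fun x => u x * ψ x) (volume.restrict Ω) :=
  (Lp.memLp u).integrable_mul (memLp_test hψ hs)

theorem integral_add_mul_test (u v : L2 Ω) {ψ : EuclideanSpace ℝ (Fin n) → ℝ} (hψ : Continuous ψ)
    (hs : HasCompactSupport ψ) :
    ∫ x in Ω, (u + v : L2 Ω) x * ψ x = (∫ x in Ω, u x * ψ x) + ∫ x in Ω, v x * ψ x := by
  rw [← integral_add (integrable_mul_test u hψ hs) (integrable_mul_test v hψ hs)]
  refine integral_congr_ae ?_
  filter_upwards [Lp.coeFn_add u v] with x hx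
  rw [hx, Pi.add_apply, add_mul]

theorem integral_smul_mul_test (r : ℝ) (u : L2 Ω) (ψ : EuclideanSpace ℝ (Fin n) → ℝ) :
    ∫ x in Ω, (r • u : L2 Ω) x * ψ x = r * ∫ x in Ω, u x * ψ x := by
  rw [← integral_const_mul]
  refine integral_congr_ae ?_
  filter_upwards [Lp.coeFn_smul r u] with x hx
  rw [hx, Pi.smul_apply, smul_eq_mul, mul_assoc]

theorem continuous_integral_test {ψ : EuclideanSpace ℝ (Fin n) → ℝ} (hψ : Continuous ψ)
    (hs : HasCompactSupport ψ) : Continuous (fun u : L2 Ω => ∫ x in Ω, u x * ψ x) := by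
  have h : (fun u : L2 Ω => ∫ x in Ω, u x * ψ x)
      = fun u : L2 Ω => inner ℝ ((memLp_test (Ω := Ω) hψ hs).toLp ψ) u := by
    funext u
    rw [L2.inner_def]
    refine integral_congr_ae ?_
    filter_upwards [(memLp_test (Ω := Ω) hψ hs).coeFn_toLp] with x hx
    rw [hx]
    simp
  rw [h]
  fun_prop

theorem continuous_pderiv {φ : EuclideanSpace ℝ (Fin n) → ℝ} (h : ContDiff ℝ ∞ φ) (i : Fin n) :
    Continuous (pderiv i φ) :=
  (h.continuous_fderiv (by simp)).clm_apply continuous_const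

theorem hasCompactSupport_pderiv {φ : EuclideanSpace ℝ (Fin n) → ℝ} (h : HasCompactSupport φ)
    (i : Fin n) : HasCompactSupport (pderiv i φ) :=
  h.fderiv_apply ℝ _

theorem IsWeakPartial.add {i : Fin n} {u v g k : L2 Ω} (h₁ : IsWeakPartial Ω i u g)
    (h₂ : IsWeakPartial Ω i v k) : IsWeakPartial Ω i (u + v) (g + k) := by
  intro φ hφ hc hs
  rw [integral_add_mul_test u v (continuous_pderiv hφ i) (hasCompactSupport_pderiv hc i),
    integral_add_mul_test g k hφ.continuous hc, h₁ φ hφ hc hs, h₂ φ hφ hc hs]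
  ring

theorem IsWeakPartial.smul {i : Fin n} {u g : L2 Ω} (r : ℝ) (h : IsWeakPartial Ω i u g) :
    IsWeakPartial Ω i (r • u) (r • g) := by
  intro φ hφ hc hs
  rw [integral_smul_mul_test, integral_smul_mul_test, h φ hφ hc hs]
  ring

theorem IsWeakPartial.zero (i : Fin n) : IsWeakPartial Ω i 0 0 := by
  intro φ hφ hc hs
  have := integral_smul_mul_test (Ω := Ω) 0 0
  simp only [zero_smul, zero_mul] at this
  rw [this, this, neg_zero]

theorem isClosed_isWeakPartial (i : Fin n) :
    IsClosed {q : L2 Ω × L2 Ω | IsWeakPartial Ω i q.1 q.2} := by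
  simp only [IsWeakPartial, ofPred_forall]
  refine isClosed_iInter fun φ => isClosed_iInter fun hφ => isClosed_iInter fun hc =>
    isClosed_iInter fun _ => isClosed_eq ?_ ?_
  · exact (continuous_integral_test (continuous_pderiv hφ i)
      (hasCompactSupport_pderiv hc i)).comp continuous_fst
  · exact ((continuous_integral_test hφ.continuous hc).comp continuous_snd).neg

theorem IsWeakPartial.unique (hΩ : IsOpen Ω) {i : Fin n} {u g k : L2 Ω}
    (h₁ : IsWeakPartial Ω i u g) (h₂ : IsWeakPartial Ω i u k) : g = k := by
  have hli : ∀ f : L2 Ω, LocallyIntegrableOn f Ω volume := by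
    intro f x _
    obtain ⟨t, ht, hft⟩ := (Lp.memLp f).locallyIntegrable (by norm_num) x
    refine ⟨t ∩ Ω, inter_mem (mem_nhdsWithin_of_mem_nhds ht) self_mem_nhdsWithin, ?_⟩
    rwa [IntegrableOn, Measure.restrict_restrict' hΩ.measurableSet] at hft
  have h0 := hΩ.ae_eq_zero_of_integral_contDiff_smul_eq_zero ((hli g).sub (hli k)) (by
    intro φ hφ hc hs
    have e : ∫ x in Ω, g x * φ x = ∫ x in Ω, k x * φ x := by
      have e₁ := h₁ φ hφ hc hs
      have e₂ := h₂ φ hφ hc hs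
      linarith
    have hz : ∀ x, x ∉ Ω → φ x • (g x - k x) = 0 := fun x hx => by
      rw [image_eq_zero_of_notMem_tsupport (fun h => hx (hs h)), zero_smul]
    have := setIntegral_eq_integral_of_forall_compl_eq_zero (μ := volume) hz
    rw [Pi.sub_def, ← this]
    rw [← sub_eq_zero, ← integral_sub (integrable_mul_test g hφ.continuous hc)
      (integrable_mul_test k hφ.continuous hc)] at e
    rw [← e]
    refine integral_congr_ae (Eventually.of_forall fun x => ?_)
    simp only [smul_eq_mul]
    ring)
  refine Lp.ext ?_
  rw [EventuallyEq, ae_restrict_iff' hΩ.measurableSet]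
  filter_upwards [h0] with x hx hxΩ
  exact sub_eq_zero.1 (hx hxΩ)

end testing

/-- The functions in `L²(Ω)` with weak derivatives of order up to two in `L²(Ω)`, listed together
with these derivatives. -/
def h2Submodule {n : ℕ} (Ω : Set (EuclideanSpace ℝ (Fin n))) : Submodule ℝ (Jet Ω) where
  carrier := {w | (∀ i, IsWeakPartial Ω i (w (.inl ())) (w (.inr (.inl i)))) ∧
    ∀ i j, IsWeakPartial Ω j (w (.inr (.inl i))) (w (.inr (.inr (i, j))))}
  add_mem' h₁ h₂ := ⟨fun i => (h₁.1 i).add (h₂.1 i), fun i j => (h₁.2 i j).add (h₂.2 i j)⟩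
  zero_mem' := ⟨fun i => IsWeakPartial.zero i, fun _ j => IsWeakPartial.zero j⟩
  smul_mem' r _ h := ⟨fun i => (h.1 i).smul r, fun i j => (h.2 i j).smul r⟩

/-- The Sobolev space `H²(Ω) = W^{2,2}(Ω)`. An element is a function `u ∈ L²(Ω)` together with its
weak derivatives `∂ᵢu`, `∂ᵢⱼu ∈ L²(Ω)` (which `u` determines, see `H2.ext_val`); the norm is
`(‖u‖² + ∑ᵢ ‖∂ᵢu‖² + ∑ᵢⱼ ‖∂ᵢⱼu‖²)^{1/2}` with `L²(Ω)`-norms. -/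
abbrev H2 {n : ℕ} (Ω : Set (EuclideanSpace ℝ (Fin n))) : Type := h2Submodule Ω

namespace H2

variable {n : ℕ} {Ω : Set (EuclideanSpace ℝ (Fin n))}

/-- The function `u` underlying an element of `H²(Ω)`. -/
def val (u : H2 Ω) : L2 Ω := (u : Jet Ω) (.inl ())

/-- The weak derivative `∂ᵢu`. -/
def grad (u : H2 Ω) (i : Fin n) : L2 Ω := (u : Jet Ω) (.inr (.inl i))

/-- The weak derivative `∂ᵢⱼu`. -/
def hess (u : H2 Ω) (i j : Fin n) : L2 Ω := (u : Jet Ω) (.inr (.inr (i, j)))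

theorem ext_val (hΩ : IsOpen Ω) {u v : H2 Ω} (h : u.val = v.val) : u = v := by
  have h₁ : ∀ i, u.grad i = v.grad i := fun i =>
    IsWeakPartial.unique hΩ (u.2.1 i) (by have := v.2.1 i; exact (congrArg (fun f => IsWeakPartial Ω i f (v.grad i)) h).mpr this)
  have h₂ : ∀ i j, u.hess i j = v.hess i j := fun i j =>
    IsWeakPartial.unique hΩ (u.2.2 i j)
      (by have := v.2.2 i j; exact (congrArg (fun f => IsWeakPartial Ω j f (v.hess i j)) (h₁ i)).mpr this)
  refine Subtype.ext (PiLp.ext ?_)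
  rintro (_ | i | ⟨i, j⟩)
  exacts [h, h₁ i, h₂ i j]

/-- `H²(Ω)` is a Banach space. -/
instance : CompleteSpace (H2 Ω) := by
  have hc : ∀ k : JetIndex n, Continuous fun w : Jet Ω => w k := fun k => by fun_prop
  have : IsClosed (h2Submodule Ω : Set (Jet Ω)) := by
    have h : (h2Submodule Ω : Set (Jet Ω))
        = (⋂ i, {w : Jet Ω | IsWeakPartial Ω i (w (.inl ())) (w (.inr (.inl i)))}) ∩
          ⋂ i, ⋂ j, {w : Jet Ω |
            IsWeakPartial Ω j (w (.inr (.inl i))) (w (.inr (.inr (i, j))))} := by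
      ext w
      simp [h2Submodule]
    rw [h]
    exact (isClosed_iInter fun i =>
        (isClosed_isWeakPartial i).preimage ((hc _).prodMk (hc _))).inter
      (isClosed_iInter fun i => isClosed_iInter fun j =>
        (isClosed_isWeakPartial j).preimage ((hc _).prodMk (hc _)))
  exact this.completeSpace_coe

/-- `v` and `p` are pointwise representatives of `u` and of its weak gradient. -/
def IsRepresentative (u : H2 Ω) (v : EuclideanSpace ℝ (Fin n) → ℝ)
    (p : EuclideanSpace ℝ (Fin n) → Fin n → ℝ) : Prop :=
  v =ᵐ[volume.restrict Ω] u.val ∧ ∀ i, (fun x => p x i) =ᵐ[volume.restrict Ω] u.grad i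

end H2

/-! ### Semismoothness -/

/-- `F` is `D`-semismooth in the open set `V`, i.e. the set-valued map `D` is a generalized
differential of `F` in `V`. -/
structure IsSemismoothOn {Y Z : Type*} [NormedAddCommGroup Y] [NormedSpace ℝ Y] [CompleteSpace Y]
    [NormedAddCommGroup Z] [NormedSpace ℝ Z] [CompleteSpace Z]
    (F : Y → Z) (D : Y → Set (Y →L[ℝ] Z)) (V : Set Y) : Prop where
  isOpen : IsOpen V
  nonempty : ∀ y ∈ V, (D y).Nonempty
  continuous_near : ∀ y ∈ V, ∀ᶠ z in 𝓝 y, ContinuousAt F z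
  sup_isLittleO : ∀ y ∈ V, ∀ ε > 0, ∀ᶠ s in 𝓝 (0 : Y), ∀ M ∈ D (y + s),
    ‖F (y + s) - F y - M s‖ ≤ ε * ‖s‖

/-! ### The HJBI operator -/

/-- The coefficients `a^{ij}(x)`, `b^i(x,α,β)`, `c(x,α,β)`, `f(x,α,β)` of an HJBI operator. -/
structure HJBIData (n : ℕ) (A B : Type*) where
  a : Fin n → Fin n → EuclideanSpace ℝ (Fin n) → ℝ
  b : Fin n → EuclideanSpace ℝ (Fin n) → A → B → ℝ
  c : EuclideanSpace ℝ (Fin n) → A → B → ℝ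
  f : EuclideanSpace ℝ (Fin n) → A → B → ℝ

/-- `φ ∈ L^∞(Ω × A × B)`, with `φ(x,α,·)` continuous on `B` for all `(x,α) ∈ Ω × A`. Here
`NullMeasurable` with respect to Lebesgue measure on `Ω` is Lebesgue measurability on `Ω`. -/
structure IsAdmissibleCoeff {n : ℕ} {A B : Type*} [TopologicalSpace B]
    (Ω : Set (EuclideanSpace ℝ (Fin n))) (φ : EuclideanSpace ℝ (Fin n) → A → B → ℝ) : Prop where
  measurable : ∀ α β, NullMeasurable (fun x => φ x α β) (volume.restrict Ω)
  bounded : ∃ K : ℝ, ∀ᵐ x ∂volume.restrict Ω, ∀ α β, |φ x α β| ≤ K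
  continuous : ∀ x ∈ Ω, ∀ α, Continuous (φ x α)

namespace HJBIData

variable {n : ℕ} {A B : Type*}

/-- The standing assumptions on the coefficients. -/
structure IsAdmissible [TopologicalSpace B] (P : HJBIData n A B)
    (Ω : Set (EuclideanSpace ℝ (Fin n))) : Prop where
  a_continuous : ∀ i j, ContinuousOn (P.a i j) (closure Ω)
  elliptic : ∃ lam > (0 : ℝ), ∀ x ∈ Ω, ∀ ξ : Fin n → ℝ,
    lam * ∑ i, ξ i ^ 2 ≤ ∑ i, ∑ j, P.a i j x * ξ i * ξ j
  b_coeff : ∀ i, IsAdmissibleCoeff Ω (P.b i)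
  c_coeff : IsAdmissibleCoeff Ω P.c
  f_coeff : IsAdmissibleCoeff Ω P.f
  c_nonneg : ∀ x ∈ Ω, ∀ α β, 0 ≤ P.c x α β

/-- `ℓ(x,(z,p),α,β) = b^i(x,α,β) pᵢ + c(x,α,β) z - f(x,α,β)`. -/
def ell (P : HJBIData n A B) (x : EuclideanSpace ℝ (Fin n)) (z : ℝ) (p : Fin n → ℝ)
    (α : A) (β : B) : ℝ :=
  (∑ i, P.b i x α β * p i) + P.c x α β * z - P.f x α β

/-- `h(x,(z,p),α) = min_β ℓ(x,(z,p),α,β)`; on `Ω` the minimum is attained, since `B` is compact and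
`ℓ` is continuous in `β`. -/
def innerMin (P : HJBIData n A B) (x : EuclideanSpace ℝ (Fin n)) (z : ℝ) (p : Fin n → ℝ)
    (α : A) : ℝ :=
  ⨅ β, P.ell x z p α β

/-- The Hamiltonian `G(x,z,p) = max_α min_β ℓ(x,(z,p),α,β)` (`A` is finite). -/
def hamiltonian (P : HJBIData n A B) (x : EuclideanSpace ℝ (Fin n)) (z : ℝ) (p : Fin n → ℝ) : ℝ :=
  ⨆ α, P.innerMin x z p α

variable {Ω : Set (EuclideanSpace ℝ (Fin n))}

/-- `F : H²(Ω) → L²(Ω)` is the HJBI operator `F(u) = -a^{ij} ∂ᵢⱼu + G(·,u,∇u)`. -/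
def IsOperator (P : HJBIData n A B) (F : H2 Ω → L2 Ω) : Prop :=
  ∀ u, F u =ᵐ[volume.restrict Ω] fun x =>
    -(∑ i, ∑ j, P.a i j x * u.hess i j x) + P.hamiltonian x (u.val x) (fun i => u.grad i x)

/-- `M` is the operator
`-a^{ij} ∂ᵢⱼ + b^i(·,α(·),β(·)) ∂ᵢ + c(·,α(·),β(·))` in `𝓛(H²(Ω), L²(Ω))`. -/
def IsControlledOperator (P : HJBIData n A B) (α : EuclideanSpace ℝ (Fin n) → A)
    (β : EuclideanSpace ℝ (Fin n) → B) (M : H2 Ω →L[ℝ] L2 Ω) : Prop :=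
  ∀ w : H2 Ω, M w =ᵐ[volume.restrict Ω] fun x =>
    -(∑ i, ∑ j, P.a i j x * w.hess i j x)
      + (∑ i, P.b i x (α x) (β x) * w.grad i x) + P.c x (α x) (β x) * w.val x

/-- `β ∈ argmin_β ℓ(x,(z,p),α,β)`. -/
def IsArgmin (P : HJBIData n A B) (x : EuclideanSpace ℝ (Fin n)) (z : ℝ) (p : Fin n → ℝ)
    (α : A) (β : B) : Prop :=
  ∀ β', P.ell x z p α β ≤ P.ell x z p α β'

/-- `α ∈ argmax_α min_β ℓ(x,(z,p),α,β)`. -/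
def IsArgmax (P : HJBIData n A B) (x : EuclideanSpace ℝ (Fin n)) (z : ℝ) (p : Fin n → ℝ)
    (α : A) : Prop :=
  ∀ α', P.innerMin x z p α' ≤ P.innerMin x z p α

/-- `α : Ω → A` is measurable with `α(x)` an outer maximiser for a.e. `x ∈ Ω`, and
`β : Ω × A → B` is jointly measurable (for the Lebesgue σ-algebra on `Ω`) with `β(x,α)` an inner
minimiser for all `(x,α) ∈ Ω × A`; here `(v,p)` are pointwise values of `(u,∇u)`. -/
structure IsJointFeedback [MeasurableSpace A] [MeasurableSpace B] (P : HJBIData n A B)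
    (Ω : Set (EuclideanSpace ℝ (Fin n)))
    (v : EuclideanSpace ℝ (Fin n) → ℝ) (p : EuclideanSpace ℝ (Fin n) → Fin n → ℝ)
    (α : EuclideanSpace ℝ (Fin n) → A) (β : EuclideanSpace ℝ (Fin n) → A → B) : Prop where
  measurable_max : NullMeasurable α (volume.restrict Ω)
  measurable_min : Measurable
    (fun q : NullMeasurableSpace (EuclideanSpace ℝ (Fin n)) (volume.restrict Ω) × A => β q.1 q.2)
  isArgmax : ∀ᵐ x ∂volume.restrict Ω, P.IsArgmax x (v x) (p x) (α x)
  isArgmin : ∀ x ∈ Ω, ∀ α', P.IsArgmin x (v x) (p x) α' (β x α')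

/-- `α : Ω → A` and `β : Ω → B` are measurable and for all `x ∈ Ω`, `α(x)` is an outer maximiser and
`β(x)` an inner minimiser at `α(x)`; here `(v,p)` are pointwise values of `(u,∇u)`. -/
structure IsFeedback [MeasurableSpace A] [MeasurableSpace B] (P : HJBIData n A B)
    (Ω : Set (EuclideanSpace ℝ (Fin n)))
    (v : EuclideanSpace ℝ (Fin n) → ℝ) (p : EuclideanSpace ℝ (Fin n) → Fin n → ℝ)
    (α : EuclideanSpace ℝ (Fin n) → A) (β : EuclideanSpace ℝ (Fin n) → B) : Prop where
  measurable_max : NullMeasurable α (volume.restrict Ω)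
  measurable_min : NullMeasurable β (volume.restrict Ω)
  isArgmax : ∀ x ∈ Ω, P.IsArgmax x (v x) (p x) (α x)
  isArgmin : ∀ x ∈ Ω, P.IsArgmin x (v x) (p x) (α x) (β x)

/-- The set `∂*F(u)` of all operators
`-a^{ij} ∂ᵢⱼ + b^i(·,α(·),β^u(·,α(·))) ∂ᵢ + c(·,α(·),β^u(·,α(·)))`, with `α : Ω → A` and
`β^u : Ω × A → B` as in `IsJointFeedback`. -/
def jointDifferential [MeasurableSpace A] [MeasurableSpace B] (P : HJBIData n A B) (u : H2 Ω) :
    Set (H2 Ω →L[ℝ] L2 Ω) :=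
  {M | ∃ v p α β, u.IsRepresentative v p ∧ P.IsJointFeedback Ω v p α β ∧
    P.IsControlledOperator α (fun x => β x (α x)) M}

/-- The set of all operators
`-a^{ij} ∂ᵢⱼ + b^i(·,α^u(·),β^u(·)) ∂ᵢ + c(·,α^u(·),β^u(·))`, with `α^u : Ω → A` and
`β^u : Ω → B` as in `IsFeedback`. -/
def feedbackDifferential [MeasurableSpace A] [MeasurableSpace B] (P : HJBIData n A B)
    (u : H2 Ω) : Set (H2 Ω →L[ℝ] L2 Ω) :=
  {M | ∃ v p α β, u.IsRepresentative v p ∧ P.IsFeedback Ω v p α β ∧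
    P.IsControlledOperator α β M}

end HJBIData

end

/-! The second-order part of the operator is linear and cancels from the remainder, so only the
superposition operator of the Hamiltonian matters. If `(α, β)` are optimal controls at `u + s`, then
`ℓ` is affine in `(z, p)`, and the remainder at `x` is exactly `ℓ(x, u, ∇u, α, β) - G(x, u, ∇u)`:
the loss from using at `u` controls that are optimal at `u + s`.

Pointwise, this loss is of higher order in `σ = |s| + ∑ |∂ᵢs|`, uniformly over the admissible
controls (`exists_abs_ell_sub_hamiltonian_le`). Since `A` is finite, an outer control that is
optimal nearby is already optimal. Since `B` is compact, an inner control that is optimal nearby has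
coefficients close to those of an exact minimiser, so the loss is a small multiple of `σ`. The
remainder is also at most `2Kσ` everywhere.

Pointwise smallness passes to `L²` because the domain and target norms leave a gap: `s` and `∇s` are
bounded in `H¹`, hence their squares are equi-integrable relative to `‖s‖²` (`exists_lintegral_le`).
Along a null sequence, a subsequence has `σ → 0` a.e., so the set where the remainder exceeds `ησ`
has measure tending to zero. Off this set the norm is at most `η‖σ‖`; on it the bound `2Kσ` and
equi-integrability apply (`exists_norm_le_of_pointwise`).

Equi-integrability is obtained without Sobolev embeddings. Translations by `w` change an `H¹`
function by at most the norm of its derivative along `w`, by duality with test functions; averaging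
over a ball of small translations compares `u` on a small set with its total mass. Near the boundary
the ball is chosen inside a cone of inward directions.

Measurable optimal controls come from `exists_measurable_argmin`: a compact metrizable space is a
continuous image of the Cantor set, where a least minimiser can be picked. The two differentials
agree because controls may be altered on null sets and because an inner feedback given only along
`α` extends to all outer controls. -/

/-! ### Equi-integrability -/

section equiintegrability

variable {n : ℕ} {Ω : Set (EuclideanSpace ℝ (Fin n))}

/-- Small translations into a cone of inner directions: they keep `Ω` near `x₀` inside `Ω`. -/
theorem IsC11Domain.exists_ball_translate_mem (hΩ : IsC11Domain Ω) {x₀ : EuclideanSpace ℝ (Fin n)}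
    (hx₀ : x₀ ∈ closure Ω) :
    ∃ r > 0, ∀ η > 0, ∃ (w₀ : EuclideanSpace ℝ (Fin n)) (ρ : ℝ), 0 < ρ ∧
      ∀ w ∈ Metric.ball w₀ ρ, ‖w‖ ≤ η ∧
        ∀ x ∈ Ω ∩ Metric.ball x₀ r, ∀ s ∈ Icc (0 : ℝ) 1, x + s • w ∈ Ω := by
  by_cases hx : x₀ ∈ Ω
  · obtain ⟨ρ, hρ, hsub⟩ := Metric.isOpen_iff.1 hΩ.isOpen x₀ hx
    refine ⟨ρ / 2, by positivity, fun η hη => ⟨0, min η (ρ / 2), by positivity, ?_⟩⟩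
    intro w hw
    rw [mem_ball_zero_iff, lt_min_iff] at hw
    refine ⟨hw.1.le, fun x hx s hs => hsub ?_⟩
    have h1 := hx.2
    rw [Metric.mem_ball, dist_eq_norm] at h1 ⊢
    have h2 : ‖s • w‖ ≤ ‖w‖ := by
      rw [norm_smul, Real.norm_of_nonneg hs.1]
      exact mul_le_of_le_one_left (norm_nonneg _) hs.2
    calc ‖x + s • w - x₀‖ = ‖(x - x₀) + s • w‖ := by congr 1; abel
      _ ≤ ‖x - x₀‖ + ‖s • w‖ := norm_add_le _ _
      _ < ρ := by linarith [hw.2]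
  · have hfr : x₀ ∈ frontier Ω := by
      rw [hΩ.isOpen.frontier_eq]
      exact ⟨hx₀, hx⟩
    obtain ⟨ν, r₀, γ, K, hν, hr₀, hγ, -, hmem⟩ := hΩ.boundary x₀ hfr
    -- Near `x₀`, `Ω` is the set `Φ > 0`. Moving along `ν` leaves the argument of `γ` unchanged, so
    -- `Φ` grows at unit rate in that direction.
    set Φ : EuclideanSpace ℝ (Fin n) → ℝ := fun y => inner ℝ ν y - γ (y - inner ℝ ν y • ν) with hΦ
    have hΦc : ContDiff ℝ 1 Φ := by
      have h1 : ContDiff ℝ 1 fun y : EuclideanSpace ℝ (Fin n) => inner ℝ ν y :=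
        contDiff_const.inner ℝ contDiff_id
      exact h1.sub (hγ.comp (contDiff_id.sub (h1.smul contDiff_const)))
    have hstrict : HasStrictFDerivAt Φ (fderiv ℝ Φ x₀) x₀ :=
      hΦc.contDiffAt.hasStrictFDerivAt one_ne_zero
    set D := fderiv ℝ Φ x₀ with hD
    have hDν : D ν = 1 := by
      have h1 : HasDerivAt (fun t : ℝ => x₀ + t • ν) ν 0 := by
        simpa using ((hasDerivAt_id (0 : ℝ)).smul_const ν).const_add x₀
      have h2 : HasDerivAt (fun t : ℝ => Φ (x₀ + t • ν)) (D ν) 0 := by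
        have h3 : HasFDerivAt Φ D (x₀ + (0 : ℝ) • ν) := by simpa using hstrict.hasFDerivAt
        exact h3.comp_hasDerivAt 0 h1
      have h4 : (fun t : ℝ => Φ (x₀ + t • ν)) = fun t => Φ x₀ + t := by
        funext t
        have h5 : inner ℝ ν (x₀ + t • ν) = inner ℝ ν x₀ + t := by
          rw [inner_add_right, inner_smul_right, real_inner_self_eq_norm_sq, hν]; ring
        simp only [hΦ, h5]
        rw [add_smul, add_sub_add_right_eq_sub]
        ring
      rw [h4] at h2
      exact h2.unique ((hasDerivAt_id (0 : ℝ)).const_add _)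
    -- Strict differentiability controls differences between two arbitrary points near `x₀`. For a
    -- direction `z` with `D z > 1/2` and `‖z‖ < 2` the error is at most `(1/8) * 2 = 1/4` per unit
    -- of displacement, which is less than the gain, so `Φ` does not decrease along `z`.
    have hev : ∀ᶠ p in 𝓝 (x₀, x₀), ‖Φ p.1 - Φ p.2 - D (p.1 - p.2)‖ ≤ (1 / 8) * ‖p.1 - p.2‖ :=
      hstrict.isLittleO.def (by norm_num)
    obtain ⟨ρ₁, hρ₁, hstr'⟩ := Metric.eventually_nhds_iff_ball.1 hev
    have hstr : ∀ p ∈ Metric.ball x₀ ρ₁, ∀ q ∈ Metric.ball x₀ ρ₁,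
        ‖Φ p - Φ q - D (p - q)‖ ≤ (1 / 8) * ‖p - q‖ := fun p hp q hq =>
      hstr' (p, q) (by rw [← ball_prod_same]; exact ⟨hp, hq⟩)
    have hz : ∀ᶠ z in 𝓝 ν, 1 / 2 < D z ∧ ‖z‖ < 2 :=
      (D.continuous.continuousAt.eventually (lt_mem_nhds (by rw [hDν]; norm_num))).and
        (continuous_norm.continuousAt.eventually (gt_mem_nhds (by simp [hν])))
    obtain ⟨ρ₂, hρ₂, hz⟩ := Metric.eventually_nhds_iff_ball.1 hz
    set r := min r₀ ρ₁ / 2 with hr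
    have hrpos : 0 < r := by positivity
    refine ⟨r, hrpos, fun η hη => ?_⟩
    -- Since `‖z‖ < 2`, the translation `h • z` is shorter than both `η` and `r`.
    set h := min η r / 2 with hh
    have hhpos : 0 < h := by positivity
    refine ⟨h • ν, h * ρ₂, by positivity, fun w hw => ?_⟩
    obtain ⟨z, rfl⟩ : ∃ z, w = h • z := ⟨h⁻¹ • w, by rw [smul_smul, mul_inv_cancel₀ hhpos.ne', one_smul]⟩
    have hzν : z ∈ Metric.ball ν ρ₂ := by
      rw [Metric.mem_ball, dist_smul₀, Real.norm_of_nonneg hhpos.le] at hw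
      exact lt_of_mul_lt_mul_left hw hhpos.le
    obtain ⟨hz1, hz2⟩ := hz z hzν
    have hnorm : ‖h • z‖ ≤ min η r := by
      rw [norm_smul, Real.norm_of_nonneg hhpos.le]
      have : h * 2 = min η r := by rw [hh]; ring
      nlinarith
    refine ⟨hnorm.trans (min_le_left _ _), fun x hx s hs => ?_⟩
    have hxr := hx.2
    have hb : x + s • h • z ∈ Metric.ball x₀ (min r₀ ρ₁) := by
      rw [Metric.mem_ball, dist_eq_norm] at hxr ⊢
      have h2 : ‖s • h • z‖ ≤ ‖h • z‖ := by
        rw [norm_smul s, Real.norm_of_nonneg hs.1]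
        exact mul_le_of_le_one_left (norm_nonneg _) hs.2
      have h3 := hnorm.trans (min_le_right _ _)
      calc ‖x + s • h • z - x₀‖ = ‖(x - x₀) + s • h • z‖ := by congr 1; abel
        _ ≤ ‖x - x₀‖ + ‖s • h • z‖ := norm_add_le _ _
        _ < r + r := by linarith
        _ = min r₀ ρ₁ := by rw [hr]; ring
    have hxb : x ∈ Metric.ball x₀ (min r₀ ρ₁) :=
      Metric.ball_subset_ball (by rw [hr]; linarith [lt_min hr₀ hρ₁]) hxr
    have hxΦ : 0 < Φ x :=
      sub_pos.2 ((hmem x (Metric.ball_subset_ball (min_le_left _ _) hxb)).1 hx.1)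
    refine (hmem _ (Metric.ball_subset_ball (min_le_left _ _) hb)).2 (sub_pos.1 ?_)
    change 0 < Φ (x + s • h • z)
    have key := hstr _ (Metric.ball_subset_ball (min_le_right _ _) hb) _
      (Metric.ball_subset_ball (min_le_right _ _) hxb)
    simp only [add_sub_cancel_left, map_smul, smul_eq_mul, norm_smul, Real.norm_eq_abs,
      abs_of_nonneg hs.1, abs_of_pos hhpos] at key
    have h4 := (abs_le.1 key).1
    have h5 : 0 ≤ s * h := mul_nonneg hs.1 hhpos.le
    nlinarith [mul_le_mul_of_nonneg_left hz1.le h5, mul_le_mul_of_nonneg_left hz2.le h5]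

/-- A bound on the pairings with test functions bounds the `L²`-norm. -/
theorem eLpNorm_le_of_forall_test {V : Set (EuclideanSpace ℝ (Fin n))} (hV : IsOpen V)
    {g : EuclideanSpace ℝ (Fin n) → ℝ} (hg : MemLp g 2 (volume.restrict V)) {C : ℝ} (hC₀ : 0 ≤ C)
    (hC : ∀ φ : EuclideanSpace ℝ (Fin n) → ℝ, ContDiff ℝ ∞ φ → HasCompactSupport φ →
      tsupport φ ⊆ V → |∫ x in V, g x * φ x| ≤ C * (eLpNorm φ 2 (volume.restrict V)).toReal) :
    ‖hg.toLp g‖ ≤ C := by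
  let S : Submodule ℝ (L2 V) :=
    { carrier := {w | ∃ φ : EuclideanSpace ℝ (Fin n) → ℝ, ContDiff ℝ ∞ φ ∧ HasCompactSupport φ ∧
        tsupport φ ⊆ V ∧ w =ᵐ[volume.restrict V] φ}
      add_mem' := by
        rintro a b ⟨φ, h1, h2, h3, h4⟩ ⟨ψ, k1, k2, k3, k4⟩
        exact ⟨φ + ψ, h1.add k1, h2.add k2, (tsupport_add φ ψ).trans (union_subset h3 k3),
          (Lp.coeFn_add a b).trans (h4.add k4)⟩
      zero_mem' := ⟨0, contDiff_const, HasCompactSupport.zero, by simp [tsupport],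
        Lp.coeFn_zero ℝ 2 (volume.restrict V)⟩
      smul_mem' := by
        rintro c a ⟨φ, h1, h2, h3, h4⟩
        refine ⟨c • φ, h1.const_smul c, h2.smul_left (f := fun _ => c), (tsupport_smul_subset_right (fun _ => c) φ).trans h3, ?_⟩
        filter_upwards [Lp.coeFn_smul c a, h4] with x hx hx'
        rw [hx, Pi.smul_apply, Pi.smul_apply, hx'] }
  have hpair : ∀ (w : L2 V) (φ : EuclideanSpace ℝ (Fin n) → ℝ), w =ᵐ[volume.restrict V] φ →
      ∀ v : L2 V, inner ℝ w v = ∫ x in V, v x * φ x := by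
    intro w φ hw v
    rw [L2.inner_def]
    refine integral_congr_ae ?_
    filter_upwards [hw] with x hx
    rw [hx]
    simp
  -- An element orthogonal to all test functions vanishes a.e., by the fundamental lemma of the
  -- calculus of variations.
  have hdense : S.topologicalClosure = ⊤ := by
    rw [Submodule.topologicalClosure_eq_top_iff, Submodule.eq_bot_iff]
    intro v hv
    have hloc : LocallyIntegrableOn v V volume := by
      intro x _
      obtain ⟨t, ht, hft⟩ := (Lp.memLp v).locallyIntegrable (by norm_num) x
      refine ⟨t ∩ V, inter_mem (mem_nhdsWithin_of_mem_nhds ht) self_mem_nhdsWithin, ?_⟩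
      rwa [IntegrableOn, Measure.restrict_restrict' hV.measurableSet] at hft
    have h0 := hV.ae_eq_zero_of_integral_contDiff_smul_eq_zero hloc (by
      intro φ hφ hc hs
      have hm : (memLp_test (Ω := V) hφ.continuous hc).toLp φ ∈ S :=
        ⟨φ, hφ, hc, hs, MemLp.coeFn_toLp _⟩
      have := (Submodule.mem_orthogonal S v).1 hv _ hm
      rw [hpair _ φ (MemLp.coeFn_toLp _)] at this
      rw [← setIntegral_eq_integral_of_forall_compl_eq_zero (s := V), ← this]
      · exact integral_congr_ae (Eventually.of_forall fun x => mul_comm _ _)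
      · intro x hx
        rw [image_eq_zero_of_notMem_tsupport (fun h => hx (hs h)), zero_smul])
    refine Lp.ext ?_
    have h1 : ∀ᵐ x ∂volume.restrict V, v x = 0 := (ae_restrict_iff' hV.measurableSet).2 h0
    filter_upwards [h1, Lp.coeFn_zero ℝ 2 (volume.restrict V)] with x hx hx'
    rw [hx, hx', Pi.zero_apply]
  set G := hg.toLp g
  -- The bound extends from the dense subspace by continuity; the choice `w = G` then gives `‖G‖² ≤
  -- C‖G‖`.
  have hall : ∀ w : L2 V, |inner ℝ w G| ≤ C * ‖w‖ := by
    have hcl : IsClosed {w : L2 V | |inner ℝ w G| ≤ C * ‖w‖} :=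
      isClosed_le (by fun_prop) (by fun_prop)
    have hS : (S : Set (L2 V)) ⊆ {w : L2 V | |inner ℝ w G| ≤ C * ‖w‖} := by
      rintro w ⟨φ, h1, h2, h3, h4⟩
      have := hC φ h1 h2 h3
      rw [mem_ofPred_eq, hpair w φ h4, Lp.norm_def, eLpNorm_congr_ae h4]
      convert this using 2
      refine integral_congr_ae ?_
      filter_upwards [hg.coeFn_toLp] with x hx
      rw [hx]
    intro w
    have hw : w ∈ closure (S : Set (L2 V)) := by
      rw [← Submodule.topologicalClosure_coe, hdense]; trivial
    exact closure_minimal hS hcl hw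
  by_contra! hlt
  have h1 := hall G
  rw [real_inner_self_eq_norm_sq, abs_of_nonneg (sq_nonneg _)] at h1
  have hGn : 0 ≤ ‖G‖ := norm_nonneg _
  nlinarith

theorem lintegral_enorm_sq_eq {X : Type*} [MeasurableSpace X] {μ : Measure X} (f : X → ℝ) :
    ∫⁻ x, ‖f x‖ₑ ^ 2 ∂μ = eLpNorm f 2 μ ^ 2 := by
  have := eLpNorm_nnreal_pow_eq_lintegral (f := f) (μ := μ) (p := 2) two_ne_zero
  simp only [NNReal.coe_ofNat, ENNReal.coe_ofNat, ENNReal.rpow_ofNat] at this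
  exact this.symm

theorem integral_mul_test_eq_inner (v : L2 Ω) {φ : EuclideanSpace ℝ (Fin n) → ℝ}
    (hφ : MemLp φ 2 (volume.restrict Ω)) :
    ∫ x in Ω, v x * φ x = inner ℝ (hφ.toLp φ) v := by
  rw [L2.inner_def]
  refine integral_congr_ae ?_
  filter_upwards [hφ.coeFn_toLp] with x hx
  rw [hx]
  simp

theorem abs_integral_mul_test_le (v : L2 Ω) {φ : EuclideanSpace ℝ (Fin n) → ℝ}
    (hφ : MemLp φ 2 (volume.restrict Ω)) :
    |∫ x in Ω, v x * φ x| ≤ ‖v‖ * (eLpNorm φ 2 (volume.restrict Ω)).toReal := by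
  rw [integral_mul_test_eq_inner v hφ, mul_comm, ← Lp.norm_toLp φ hφ]
  exact abs_real_inner_le_norm _ _

theorem fderiv_apply_eq_sum_pderiv (φ : EuclideanSpace ℝ (Fin n) → ℝ)
    (x w : EuclideanSpace ℝ (Fin n)) : fderiv ℝ φ x w = ∑ i, w i * pderiv i φ x := by
  conv_lhs => rw [← (EuclideanSpace.basisFun (Fin n) ℝ).sum_repr w]
  simp [pderiv]

theorem integral_mul_fderiv_eq {u : L2 Ω} {g : Fin n → L2 Ω} (hg : ∀ i, IsWeakPartial Ω i u (g i))
    (w : EuclideanSpace ℝ (Fin n)) {φ : EuclideanSpace ℝ (Fin n) → ℝ} (hφ : ContDiff ℝ ∞ φ)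
    (hc : HasCompactSupport φ) (hs : tsupport φ ⊆ Ω) :
    ∫ x in Ω, u x * fderiv ℝ φ x w = - ∫ x in Ω, (∑ i, w i • g i : L2 Ω) x * φ x := by
  have h1 : ∀ x, u x * fderiv ℝ φ x w = ∑ i, w i * (u x * pderiv i φ x) := fun x => by
    rw [fderiv_apply_eq_sum_pderiv, Finset.mul_sum]
    exact Finset.sum_congr rfl fun i _ => by ring
  simp_rw [h1]
  rw [integral_finsetSum _ fun i _ => (integrable_mul_test u (continuous_pderiv hφ i)
    (hasCompactSupport_pderiv hc i)).const_mul (w i)]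
  rw [integral_mul_test_eq_inner _ (memLp_test hφ.continuous hc), inner_sum, ← Finset.sum_neg_distrib]
  refine Finset.sum_congr rfl fun i _ => ?_
  rw [integral_const_mul, hg i φ hφ hc hs, inner_smul_right,
    integral_mul_test_eq_inner _ (memLp_test hφ.continuous hc)]
  ring

/-- The pairing of `u` with a translated test function changes at most by the directional weak
derivative. -/
theorem abs_integral_translate_test_sub_le [IsFiniteMeasure (volume.restrict Ω)]
    {u : L2 Ω} {g : Fin n → L2 Ω}
    (hg : ∀ i, IsWeakPartial Ω i u (g i)) {V : Set (EuclideanSpace ℝ (Fin n))}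
    {w : EuclideanSpace ℝ (Fin n)} (hw : ∀ x ∈ V, ∀ s ∈ Icc (0 : ℝ) 1, x + s • w ∈ Ω)
    {φ : EuclideanSpace ℝ (Fin n) → ℝ} (hφ : ContDiff ℝ ∞ φ)
    (hc : HasCompactSupport φ) (hs : tsupport φ ⊆ V) :
    |(∫ x in Ω, u x * φ (x - w)) - ∫ x in Ω, u x * φ x|
      ≤ ‖(∑ i, w i • g i : L2 Ω)‖ * (eLpNorm φ 2 (volume.restrict V)).toReal := by
  have hshift : ∀ s : ℝ, ContDiff ℝ ∞ (fun x => φ (x - s • w)) ∧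
      HasCompactSupport (fun x => φ (x - s • w)) := fun s =>
    ⟨hφ.comp (contDiff_id.sub contDiff_const),
      hc.comp_homeomorph (Homeomorph.subRight (s • w))⟩
  have hsupp : ∀ s ∈ Icc (0 : ℝ) 1, tsupport (fun x => φ (x - s • w)) ⊆ Ω := by
    intro s hs01 x hx
    have h1 : x - s • w ∈ tsupport φ := by
      have := tsupport_comp_subset_preimage φ (f := fun x => x - s • w) (by fun_prop) hx
      exact this
    have := hw _ (hs h1) s hs01
    rwa [sub_add_cancel] at this
  have hfd : ∀ (s : ℝ) x, fderiv ℝ (fun x => φ (x - s • w)) x = fderiv ℝ φ (x - s • w) := fun s x => by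
    simp_rw [sub_eq_add_neg]
    exact fderiv_comp_add_right (𝕜 := ℝ) (f := φ) (-(s • w))
  obtain ⟨K, hK⟩ : ∃ K, ∀ x, ‖fderiv ℝ φ x w‖ ≤ K :=
    ((hφ.continuous_fderiv (by simp)).clm_apply continuous_const).bounded_above_of_compact_support
      (hc.fderiv_apply ℝ w)
  have hui : Integrable u (volume.restrict Ω) := (Lp.memLp u).integrable (by norm_num)
  -- Differentiating in the translation parameter puts the derivative on `φ`. While the shifted
  -- support stays in `Ω`, the definition of weak derivative turns it into a pairing with `∑ wᵢ gᵢ`,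
  -- and the mean value inequality on `[0, 1]` concludes.
  have hder : ∀ s : ℝ, HasDerivAt (fun s => ∫ x in Ω, u x * φ (x - s • w))
      (∫ x in Ω, u x * -(fderiv ℝ φ (x - s • w) w)) s := by
    intro s
    refine (hasDerivAt_integral_of_dominated_loc_of_deriv_le (s := univ) (bound := fun x => ‖u x‖ * K)
      (F' := fun s x => u x * -(fderiv ℝ φ (x - s • w) w)) univ_mem
      (Eventually.of_forall fun s => ?_) ?_ ?_ ?_ ?_ ?_).2
    · exact (integrable_mul_test u (hshift s).1.continuous (hshift s).2).aestronglyMeasurable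
    · exact integrable_mul_test u (hshift s).1.continuous (hshift s).2
    · refine (Lp.aestronglyMeasurable u).mul (Continuous.aestronglyMeasurable ?_)
      exact (((hφ.continuous_fderiv (by simp)).comp (by fun_prop)).clm_apply continuous_const).neg
    · refine Eventually.of_forall fun x s _ => ?_
      rw [norm_mul, norm_neg]
      exact mul_le_mul_of_nonneg_left (hK _) (norm_nonneg _)
    · exact hui.norm.mul_const K
    · refine Eventually.of_forall fun x s _ => HasDerivAt.const_mul _ ?_
      have h1 : HasDerivAt (fun s : ℝ => x - s • w) (-w) s := by
        simpa using ((hasDerivAt_id s).smul_const w).const_sub x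
      have h2 := ((hφ.differentiable (by simp) (x - s • w)).hasFDerivAt).comp_hasDerivAt s h1
      rw [map_neg] at h2
      exact h2
  have hN : ∀ s : ℝ, (eLpNorm (fun x => φ (x - s • w)) 2 (volume.restrict Ω)).toReal
      ≤ (eLpNorm φ 2 (volume.restrict V)).toReal := by
    intro s
    have h1 : eLpNorm φ 2 (volume.restrict V) = eLpNorm φ 2 volume :=
      eLpNorm_restrict_eq_of_support_subset ((subset_tsupport φ).trans hs)
    have h2 : eLpNorm (fun x => φ (x - s • w)) 2 volume = eLpNorm φ 2 volume :=
      eLpNorm_comp_measurePreserving hφ.continuous.aestronglyMeasurable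
        (measurePreserving_sub_right volume (s • w))
    rw [h1]
    refine ENNReal.toReal_mono (hφ.continuous.memLp_of_hasCompactSupport hc).eLpNorm_ne_top ?_
    rw [← h2]
    exact eLpNorm_mono_measure _ Measure.restrict_le_self
  have hbd : ∀ s ∈ Icc (0 : ℝ) 1, ‖∫ x in Ω, u x * -(fderiv ℝ φ (x - s • w) w)‖
      ≤ ‖(∑ i, w i • g i : L2 Ω)‖ * (eLpNorm φ 2 (volume.restrict V)).toReal := by
    intro s hs01
    have h1 := integral_mul_fderiv_eq hg w (hshift s).1 (hshift s).2 (hsupp s hs01)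
    simp_rw [hfd] at h1
    have h2 : ∫ x in Ω, u x * -(fderiv ℝ φ (x - s • w) w)
        = ∫ x in Ω, (∑ i, w i • g i : L2 Ω) x * φ (x - s • w) := by
      simp_rw [mul_neg]
      rw [integral_neg, h1, neg_neg]
    rw [h2, Real.norm_eq_abs]
    exact (abs_integral_mul_test_le _ (memLp_test (hshift s).1.continuous (hshift s).2)).trans
      (mul_le_mul_of_nonneg_left (hN s) (norm_nonneg _))
  have := norm_image_sub_le_of_norm_deriv_le_segment' (a := 0) (b := 1)
    (fun s _ => (hder s).hasDerivWithinAt) (fun s hs => hbd s (Ico_subset_Icc_self hs)) 1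
    (right_mem_Icc.2 zero_le_one)
  simpa using this

/-- Translation estimate for functions with weak derivatives in `L²`. -/
theorem lintegral_translate_sub_le [IsFiniteMeasure (volume.restrict Ω)] (hΩ : IsOpen Ω)
    {u : L2 Ω} {g : Fin n → L2 Ω}
    (hg : ∀ i, IsWeakPartial Ω i u (g i)) {V : Set (EuclideanSpace ℝ (Fin n))} (hV : IsOpen V)
    {w : EuclideanSpace ℝ (Fin n)} (hw : ∀ x ∈ V, ∀ s ∈ Icc (0 : ℝ) 1, x + s • w ∈ Ω) :
    ∫⁻ x in V, ‖Ω.indicator u (x + w) - Ω.indicator u x‖ₑ ^ 2 ≤ ‖(∑ i, w i • g i : L2 Ω)‖ₑ ^ 2 := by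
  have hVΩ : V ⊆ Ω := fun x hx => by simpa using hw x hx 0 (by simp)
  set U := Ω.indicator u with hU
  have hUm : MemLp U 2 volume := (memLp_indicator_iff_restrict hΩ.measurableSet).2 (Lp.memLp u)
  have hUw : MemLp (fun x => U (x + w)) 2 volume :=
    hUm.comp_measurePreserving (measurePreserving_add_right volume w)
  have hd : MemLp (fun x => U (x + w) - U x) 2 (volume.restrict V) := (hUw.sub hUm).restrict V
  -- By duality it suffices to pair with a test function supported in `V`; a change of variables
  -- moves the translation from `u` to `φ`.
  have key := eLpNorm_le_of_forall_test hV hd (C := ‖(∑ i, w i • g i : L2 Ω)‖) (norm_nonneg _) (by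
    intro φ hφ hc hs
    convert abs_integral_translate_test_sub_le hg hw hφ hc hs using 2
    have hφm := hφ.continuous.memLp_of_hasCompactSupport hc (p := 2) (μ := volume)
    have hz : ∀ x ∉ V, φ x = 0 := fun x hx => image_eq_zero_of_notMem_tsupport fun h => hx (hs h)
    have hind : ∀ ψ : EuclideanSpace ℝ (Fin n) → ℝ, ∫ x in Ω, u x * ψ x = ∫ x, U x * ψ x := by
      intro ψ
      rw [← integral_indicator hΩ.measurableSet]
      exact integral_congr_ae (Eventually.of_forall fun x => by
        by_cases hx : x ∈ Ω <;> simp [hU, hx])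
    rw [setIntegral_eq_integral_of_forall_compl_eq_zero fun x hx => by rw [hz x hx, mul_zero],
      hind, hind, ← integral_add_right_eq_self (fun x => U x * φ (x - w)) w, ← integral_sub]
    · simp only [add_sub_cancel_right, sub_mul]
    · simp only [add_sub_cancel_right]
      exact hUw.integrable_mul hφm
    · exact hUm.integrable_mul hφm)
  rw [lintegral_enorm_sq_eq, ← Lp.enorm_toLp (hf := hd)]
  gcongr
  exact enorm_le_iff_norm_le.2 key

theorem IsC11Domain.isFiniteMeasure (hΩ : IsC11Domain Ω) : IsFiniteMeasure (volume.restrict Ω) :=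
  isFiniteMeasure_restrict.2 hΩ.isBounded.measure_lt_top.ne

theorem enorm_sq_le_two_mul (a b : ℝ) : ‖a‖ₑ ^ 2 ≤ 2 * ‖b - a‖ₑ ^ 2 + 2 * ‖b‖ₑ ^ 2 := by
  simp only [Real.enorm_eq_ofReal_abs, ← ENNReal.ofReal_pow (abs_nonneg _), sq_abs]
  rw [← ENNReal.ofReal_ofNat 2, ← ENNReal.ofReal_mul (by norm_num), ← ENNReal.ofReal_mul (by norm_num),
    ← ENNReal.ofReal_add (by positivity) (by positivity)]
  exact ENNReal.ofReal_le_ofReal (by nlinarith [sq_nonneg (a - 2 * b)])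

/-- Averaging the translation estimate over a set `W` of admissible translations. -/
theorem measure_mul_lintegral_le [IsFiniteMeasure (volume.restrict Ω)] (hΩ : IsOpen Ω)
    {u : L2 Ω} {g : Fin n → L2 Ω} (hg : ∀ i, IsWeakPartial Ω i u (g i)) {N : ℝ≥0∞}
    (hu : ‖u‖ₑ ≤ N) (hgN : ∀ i, ‖g i‖ₑ ≤ N) {V W E : Set (EuclideanSpace ℝ (Fin n))}
    (hV : IsOpen V) (hWm : MeasurableSet W) {η : ℝ} (hη : ∀ w ∈ W, ‖w‖ ≤ η)
    (hW : ∀ w ∈ W, ∀ x ∈ V, ∀ s ∈ Icc (0 : ℝ) 1, x + s • w ∈ Ω) (hE : E ⊆ V) :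
    volume W * ∫⁻ x in E, ‖Ω.indicator u x‖ₑ ^ 2
      ≤ volume W * (2 * (n * (ENNReal.ofReal η * N)) ^ 2) + 2 * N ^ 2 * volume E := by
  set U := Ω.indicator u with hU
  have hUmeas : Measurable U := (Lp.stronglyMeasurable u).measurable.indicator hΩ.measurableSet
  have hm₂ : Measurable fun q : EuclideanSpace ℝ (Fin n) × EuclideanSpace ℝ (Fin n) =>
      2 * ‖U (q.2 + q.1)‖ₑ ^ 2 :=
    ((hUmeas.comp (measurable_snd.add measurable_fst)).enorm.pow_const 2).const_mul 2
  have hgw : ∀ w ∈ W, ‖(∑ i, w i • g i : L2 Ω)‖ₑ ≤ n * (ENNReal.ofReal η * N) := by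
    intro w hw
    refine (enorm_sum_le _ _).trans ?_
    have : ∀ i ∈ Finset.univ, ‖w i • g i‖ₑ ≤ ENNReal.ofReal η * N := fun i _ => by
      rw [enorm_smul]
      refine mul_le_mul' ?_ (hgN i)
      rw [← ofReal_norm]
      exact ENNReal.ofReal_le_ofReal ((PiLp.norm_apply_le w i).trans (hη w hw))
    refine (Finset.sum_le_sum this).trans ?_
    simp
  calc volume W * ∫⁻ x in E, ‖U x‖ₑ ^ 2
      = ∫⁻ w in W, ∫⁻ x in E, ‖U x‖ₑ ^ 2 := by
        rw [setLIntegral_const, mul_comm]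
    -- The value at `x` is compared with the value at `x + w`; the difference is controlled by the
    -- translation estimate for each `w`.
    _ ≤ ∫⁻ w in W, (2 * (n * (ENNReal.ofReal η * N)) ^ 2 + ∫⁻ x in E, 2 * ‖U (x + w)‖ₑ ^ 2) := by
        refine setLIntegral_mono' hWm fun w hw => ?_
        calc ∫⁻ x in E, ‖U x‖ₑ ^ 2
            ≤ ∫⁻ x in E, (2 * ‖U (x + w) - U x‖ₑ ^ 2 + 2 * ‖U (x + w)‖ₑ ^ 2) :=
              lintegral_mono fun x => enorm_sq_le_two_mul _ _
          _ = 2 * (∫⁻ x in E, ‖U (x + w) - U x‖ₑ ^ 2) + ∫⁻ x in E, 2 * ‖U (x + w)‖ₑ ^ 2 := by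
              rw [lintegral_add_left, lintegral_const_mul]
              · exact ((hUmeas.comp (measurable_add_const w)).sub hUmeas).enorm.pow_const 2
              · exact (((hUmeas.comp (measurable_add_const w)).sub hUmeas).enorm.pow_const 2).const_mul 2
          _ ≤ _ := by
              gcongr
              exact (lintegral_mono_set hE).trans
                ((lintegral_translate_sub_le hΩ hg hV (hW w hw)).trans (by gcongr; exact hgw w hw))
    _ = volume W * (2 * (n * (ENNReal.ofReal η * N)) ^ 2)
          + ∫⁻ w in W, ∫⁻ x in E, 2 * ‖U (x + w)‖ₑ ^ 2 := by
        rw [lintegral_add_left measurable_const, setLIntegral_const, mul_comm]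
    _ = volume W * (2 * (n * (ENNReal.ofReal η * N)) ^ 2)
          + ∫⁻ x in E, ∫⁻ w in W, 2 * ‖U (x + w)‖ₑ ^ 2 := by
        rw [lintegral_lintegral_swap hm₂.aemeasurable]
    -- After the swap the integral over `w` is at most the full mass of `u`, whatever `x` is, so the
    -- integral over `x` only produces the factor `volume E`.
    _ ≤ volume W * (2 * (n * (ENNReal.ofReal η * N)) ^ 2) + ∫⁻ _ in E, 2 * N ^ 2 := by
        gcongr with x
        calc ∫⁻ w in W, 2 * ‖U (x + w)‖ₑ ^ 2 ≤ ∫⁻ w, 2 * ‖U (x + w)‖ₑ ^ 2 := setLIntegral_le_lintegral _ _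
          _ = 2 * ‖u‖ₑ ^ 2 := by
              rw [lintegral_add_left_eq_self (fun y => 2 * ‖U y‖ₑ ^ 2) x,
                lintegral_const_mul _ (hUmeas.enorm.pow_const 2), lintegral_enorm_sq_eq,
                eLpNorm_indicator_eq_eLpNorm_restrict hΩ.measurableSet, Lp.enorm_def]
          _ ≤ 2 * N ^ 2 := by gcongr
    _ = _ := by rw [setLIntegral_const]

/-- On a bounded `C^{1,1}` domain the squares of the functions in a bounded set of `H¹` are
equi-integrable. -/
theorem IsC11Domain.exists_lintegral_le (hΩ : IsC11Domain Ω) {ε : ℝ} (hε : 0 < ε) :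
    ∃ δ > 0, ∀ E : Set (EuclideanSpace ℝ (Fin n)), MeasurableSet E → volume E ≤ δ →
      ∀ (u : L2 Ω) (g : Fin n → L2 Ω) (N : ℝ≥0∞), (∀ i, IsWeakPartial Ω i u (g i)) → ‖u‖ₑ ≤ N →
        (∀ i, ‖g i‖ₑ ≤ N) → ∫⁻ x in Ω ∩ E, ‖u x‖ₑ ^ 2 ≤ ENNReal.ofReal ε * N ^ 2 := by
  have := hΩ.isFiniteMeasure
  have hcpt : IsCompact (closure Ω) := hΩ.isBounded.isCompact_closure
  -- The harmless intersection with `closure Ω` makes the claim a property of a subset of a compact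
  -- set. It passes to subsets and finite unions, so it need only be checked near each point.
  suffices h : ∀ ε : ℝ, 0 < ε → ∃ δ > 0, ∀ E : Set (EuclideanSpace ℝ (Fin n)), MeasurableSet E →
      volume E ≤ δ → ∀ (u : L2 Ω) (g : Fin n → L2 Ω) (N : ℝ≥0∞),
        (∀ i, IsWeakPartial Ω i u (g i)) → ‖u‖ₑ ≤ N → (∀ i, ‖g i‖ₑ ≤ N) →
        ∫⁻ x in closure Ω ∩ (Ω ∩ E), ‖u x‖ₑ ^ 2 ≤ ENNReal.ofReal ε * N ^ 2 by
    obtain ⟨δ, hδ, h⟩ := h ε hε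
    refine ⟨δ, hδ, fun E hE hEδ u g N hg hu hgN => ?_⟩
    have h1 := h E hE hEδ u g N hg hu hgN
    rwa [inter_eq_self_of_subset_right (inter_subset_left.trans subset_closure)] at h1
  refine hcpt.induction_on (p := fun S => ∀ ε : ℝ, 0 < ε → ∃ δ > 0,
      ∀ E : Set (EuclideanSpace ℝ (Fin n)), MeasurableSet E →
      volume E ≤ δ → ∀ (u : L2 Ω) (g : Fin n → L2 Ω) (N : ℝ≥0∞),
        (∀ i, IsWeakPartial Ω i u (g i)) → ‖u‖ₑ ≤ N → (∀ i, ‖g i‖ₑ ≤ N) →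
        ∫⁻ x in S ∩ (Ω ∩ E), ‖u x‖ₑ ^ 2 ≤ ENNReal.ofReal ε * N ^ 2) ?_ ?_ ?_ ?_
  · intro ε _
    exact ⟨1, one_pos, fun E _ _ u g N _ _ _ => by simp⟩
  · intro S T hST hT ε hε
    obtain ⟨δ, hδ, h⟩ := hT ε hε
    exact ⟨δ, hδ, fun E hE hEδ u g N hg hu hgN =>
      (lintegral_mono_set (inter_subset_inter_left _ hST)).trans (h E hE hEδ u g N hg hu hgN)⟩
  · intro S T hS hT ε hε
    obtain ⟨δ₁, hδ₁, h₁⟩ := hS (ε / 2) (by positivity)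
    obtain ⟨δ₂, hδ₂, h₂⟩ := hT (ε / 2) (by positivity)
    refine ⟨min δ₁ δ₂, lt_min hδ₁ hδ₂, fun E hE hEδ u g N hg hu hgN => ?_⟩
    rw [union_inter_distrib_right]
    refine (lintegral_union_le _ _ _).trans ((add_le_add
      (h₁ E hE (hEδ.trans (min_le_left _ _)) u g N hg hu hgN)
      (h₂ E hE (hEδ.trans (min_le_right _ _)) u g N hg hu hgN)).trans_eq ?_)
    rw [← add_mul, ← ENNReal.ofReal_add (by positivity) (by positivity), add_halves]
  · intro x₀ hx₀
    obtain ⟨r, hr, hcone⟩ := hΩ.exists_ball_translate_mem hx₀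
    refine ⟨Metric.ball x₀ r, mem_nhdsWithin_of_mem_nhds (Metric.ball_mem_nhds _ hr), ?_⟩
    intro ε hε
    -- This makes `2 * (n * η) ^ 2 ≤ ε / 2`, the share of the translation term.
    set η : ℝ := √ε / (2 * (n + 1)) with hη
    have hηpos : 0 < η := by positivity
    obtain ⟨w₀, ρ, hρ, hW⟩ := hcone η hηpos
    set m := volume (Metric.ball w₀ ρ) with hm
    have hm0 : m ≠ 0 := (Metric.measure_ball_pos _ _ hρ).ne'
    have hmt : m ≠ ⊤ := Metric.isBounded_ball.measure_lt_top.ne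
    -- The mass term `2 * N ^ 2 * volume E'` then contributes the other `ε / 2`, after division by
    -- `m`.
    refine ⟨m * ENNReal.ofReal (ε / 4), by positivity, fun E hE hEδ u g N hg hu hgN => ?_⟩
    set E' := Metric.ball x₀ r ∩ (Ω ∩ E) with hE'
    have hE'V : E' ⊆ Ω ∩ Metric.ball x₀ r := fun x hx => ⟨hx.2.1, hx.1⟩
    have hE'm : MeasurableSet E' :=
      measurableSet_ball.inter (hΩ.isOpen.measurableSet.inter hE)
    have key := measure_mul_lintegral_le hΩ.isOpen hg hu hgN (hΩ.isOpen.inter Metric.isOpen_ball)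
      measurableSet_ball (fun w hw => (hW w hw).1) (fun w hw => (hW w hw).2) hE'V
    have hint : ∫⁻ x in E', ‖Ω.indicator u x‖ₑ ^ 2 = ∫⁻ x in E', ‖u x‖ₑ ^ 2 :=
      setLIntegral_congr_fun hE'm fun x hx => by rw [indicator_of_mem hx.2.1]
    rw [hint] at key
    have hvol : volume E' ≤ m * ENNReal.ofReal (ε / 4) :=
      (measure_mono fun x hx => hx.2.2).trans hEδ
    have hsq : 2 * (n * η) ^ 2 ≤ ε / 2 := by
      have h1 : n * η ≤ √ε / 2 := by
        rw [hη, mul_div_assoc', div_le_div_iff₀ (by positivity) (by positivity)]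
        nlinarith [Real.sqrt_nonneg ε]
      have h2 : (n * η) ^ 2 ≤ (√ε / 2) ^ 2 := pow_le_pow_left₀ (by positivity) h1 2
      rw [div_pow, Real.sq_sqrt hε.le] at h2
      linarith
    have hsq' : 2 * (n * (ENNReal.ofReal η * N)) ^ 2 ≤ ENNReal.ofReal (ε / 2) * N ^ 2 := by
      rw [← mul_assoc, mul_pow, ← mul_assoc]
      gcongr
      rw [← ENNReal.ofReal_natCast, ← ENNReal.ofReal_mul (by positivity),
        ← ENNReal.ofReal_pow (by positivity), ← ENNReal.ofReal_ofNat 2,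
        ← ENNReal.ofReal_mul (by norm_num)]
      exact ENNReal.ofReal_le_ofReal hsq
    refine (ENNReal.mul_le_mul_iff_right hm0 hmt).1 (key.trans ?_)
    calc m * (2 * (n * (ENNReal.ofReal η * N)) ^ 2) + 2 * N ^ 2 * volume E'
        ≤ m * (ENNReal.ofReal (ε / 2) * N ^ 2) + 2 * N ^ 2 * (m * ENNReal.ofReal (ε / 4)) := by
          gcongr
      _ = m * ((ENNReal.ofReal (ε / 2) + 2 * ENNReal.ofReal (ε / 4)) * N ^ 2) := by ring
      _ = m * (ENNReal.ofReal ε * N ^ 2) := by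
          rw [← ENNReal.ofReal_ofNat 2, ← ENNReal.ofReal_mul (by norm_num),
            ← ENNReal.ofReal_add (by positivity) (by positivity)]
          congr 3
          ring

end equiintegrability

/-! ### Measurable minimisers -/

section selection

variable {X : Type*} [MeasurableSpace X] {B : Type*} [TopologicalSpace B] [CompactSpace B]
  [Nonempty B]

theorem exists_forall_le_of_continuous {f : B → ℝ} (hf : Continuous f) :
    ∃ b, (∀ b', f b ≤ f b') ∧ f b = ⨅ b', f b' := by
  obtain ⟨b, -, hb⟩ := isCompact_univ.exists_isMinOn univ_nonempty hf.continuousOn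
  have hb' : ∀ b', f b ≤ f b' := fun b' => hb (mem_univ b')
  exact ⟨b, hb', le_antisymm (le_ciInf hb') (ciInf_le ⟨f b, by rintro _ ⟨b', rfl⟩; exact hb' b'⟩ b)⟩

/-- By continuity the infimum may be taken over a countable dense set. -/
theorem measurable_iInf_of_continuous [TopologicalSpace.SeparableSpace B] {f : X → B → ℝ}
    (hm : ∀ b, Measurable fun x => f x b)
    (hc : ∀ x, Continuous (f x)) : Measurable fun x => ⨅ b, f x b := by
  have h : (fun x => ⨅ b, f x b) = fun x => ⨅ k, f x (TopologicalSpace.denseSeq B k) := by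
    funext x
    obtain ⟨b, hb, hb'⟩ := exists_forall_le_of_continuous (hc x)
    have hbdd : BddBelow (range fun k => f x (TopologicalSpace.denseSeq B k)) :=
      ⟨f x b, by rintro _ ⟨k, rfl⟩; exact hb _⟩
    rw [← hb']
    refine le_antisymm (le_ciInf fun k => hb _) ?_
    have hcl : IsClosed {b | ⨅ k, f x (TopologicalSpace.denseSeq B k) ≤ f x b} :=
      isClosed_le continuous_const (hc x)
    have : (univ : Set B) ⊆ {b | ⨅ k, f x (TopologicalSpace.denseSeq B k) ≤ f x b} := by
      rw [← (TopologicalSpace.denseRange_denseSeq B).closure_range]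
      exact closure_minimal (by rintro _ ⟨k, rfl⟩; exact ciInf_le hbdd k) hcl
    exact this (mem_univ b)
  rw [h]
  exact Measurable.iInf fun k => hm _

/-- A Carathéodory function on a compact metrizable space has a measurable minimiser. -/
theorem exists_measurable_argmin [TopologicalSpace.MetrizableSpace B] [MeasurableSpace B]
    [BorelSpace B] {f : X → B → ℝ} (hm : ∀ b, Measurable fun x => f x b)
    (hc : ∀ x, Continuous (f x)) : ∃ β : X → B, Measurable β ∧ ∀ x b, f x (β x) ≤ f x b := by
  let _ := TopologicalSpace.metrizableSpaceMetric B
  -- Parametrising `B` by the Cantor set brings in the order of `ℝ`: the minimisers pull back to a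
  -- nonempty compact set of reals, whose least element is a canonical choice.
  obtain ⟨g₀, hg₀, hg₀s⟩ := exists_nat_bool_continuous_surjective_of_compact B
  set g : cantorSet → B := g₀ ∘ cantorSetHomeomorphNatToBool with hg
  have hgc : Continuous g := hg₀.comp cantorSetHomeomorphNatToBool.continuous
  have hgs : Function.Surjective g := hg₀s.comp cantorSetHomeomorphNatToBool.surjective
  set m : X → ℝ := fun x => ⨅ b, f x b with hmdef
  have hmm : Measurable m := measurable_iInf_of_continuous hm hc
  have hmle : ∀ x b, m x ≤ f x b := fun x b => by
    obtain ⟨b₀, hb₀, hb₀'⟩ := exists_forall_le_of_continuous (hc x)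
    exact hb₀'.symm.le.trans (hb₀ b)
  let S : X → Set ℝ := fun x => Subtype.val '' {s : cantorSet | f x (g s) = m x}
  have hScl : ∀ x, IsClosed (S x) := fun x =>
    isClosed_cantorSet.isClosedEmbedding_subtypeVal.isClosedMap _
      (isClosed_eq ((hc x).comp hgc) continuous_const)
  have hSne : ∀ x, (S x).Nonempty := fun x => by
    obtain ⟨b, -, hb⟩ := exists_forall_le_of_continuous (hc x)
    obtain ⟨s, rfl⟩ := hgs b
    exact ⟨s, s, hb, rfl⟩
  have hSbdd : ∀ x, BddBelow (S x) := fun x =>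
    ⟨0, by rintro _ ⟨s, -, rfl⟩; exact (cantorSet_subset_unitInterval s.2).1⟩
  have hmem : ∀ x, sInf (S x) ∈ S x := fun x => (hScl x).csInf_mem (hSne x) (hSbdd x)
  have hmemC : ∀ x, sInf (S x) ∈ cantorSet := fun x => by
    obtain ⟨s, -, hs⟩ := hmem x
    exact hs ▸ s.2
  have hmeas : Measurable fun x => sInf (S x) := by
    refine measurable_of_Iic fun t => ?_
    let T : Set cantorSet := {s | (s : ℝ) ≤ t}
    have hTcl : IsClosed T := isClosed_le continuous_subtype_val continuous_const
    have : CompactSpace cantorSet := isCompact_iff_compactSpace.1 isCompact_cantorSet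
    have : CompactSpace T := isCompact_iff_compactSpace.1 hTcl.isCompact
    -- The least parameter is at most `t` exactly when the minimum over parameters up to `t` is
    -- already the global minimum, which is an equation between measurable functions.
    have hiff : ∀ x, sInf (S x) ≤ t ↔ ∃ s : T, f x (g s) = m x := by
      intro x
      constructor
      · intro h
        obtain ⟨s, hs, hs'⟩ := hmem x
        exact ⟨⟨s, by change (s : ℝ) ≤ t; rw [hs']; exact h⟩, hs⟩
      · rintro ⟨s, hs⟩
        exact (csInf_le (hSbdd x) ⟨s, hs, rfl⟩).trans s.2
    rcases isEmpty_or_nonempty T with hT | hT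
    · convert MeasurableSet.empty (α := X)
      ext x
      simp [hiff]
    · have hcont : ∀ x, Continuous fun s : T => f x (g s) := fun x =>
        (hc x).comp (hgc.comp continuous_subtype_val)
      have h1 : (fun x => sInf (S x)) ⁻¹' Iic t = {x | ⨅ s : T, f x (g s) = m x} := by
        ext x
        obtain ⟨s, hs, hs'⟩ := exists_forall_le_of_continuous (hcont x)
        simp only [mem_preimage, mem_Iic, hiff, mem_ofPred_eq]
        constructor
        · rintro ⟨s₁, hs₁⟩
          rw [← hs']
          exact le_antisymm ((hs s₁).trans hs₁.le) (hmle _ _)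
        · intro h
          exact ⟨s, hs'.trans h⟩
      rw [h1]
      exact measurableSet_eq_fun
        (measurable_iInf_of_continuous (fun s : T => hm (g s)) hcont) hmm
  refine ⟨fun x => g ⟨sInf (S x), hmemC x⟩, hgc.measurable.comp (hmeas.subtype_mk), fun x b => ?_⟩
  obtain ⟨s, hs, hs'⟩ := hmem x
  have : (⟨sInf (S x), hmemC x⟩ : cantorSet) = s := Subtype.ext hs'.symm
  change f x (g ⟨sInf (S x), hmemC x⟩) ≤ f x b
  rw [this]
  exact (Eq.le hs).trans (hmle x b)

end selection

/-! ### The Hamiltonian pointwise -/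

namespace HJBIData

/-! ### Lipschitz bounds and semismoothness at a fixed point -/

section pointwise

variable {n : ℕ} {A B : Type*} (P : HJBIData n A B) {x : EuclideanSpace ℝ (Fin n)}
  {z z' : ℝ} {p p' : Fin n → ℝ} {α : A} {β : B} {K : ℝ}

/-- The coefficients `b`, `c`, `f` are bounded by `K` at the point `x`. -/
def BoundedAt (x : EuclideanSpace ℝ (Fin n)) (K : ℝ) : Prop :=
  ∀ α β, (∀ i, |P.b i x α β| ≤ K) ∧ |P.c x α β| ≤ K ∧ |P.f x α β| ≤ K

variable {P}

theorem abs_sum_mul_add_mul_le {b : Fin n → ℝ} {c L : ℝ} (hb : ∀ i, |b i| ≤ L) (hc : |c| ≤ L) :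
    |(∑ i, b i * p i) + c * z| ≤ L * (|z| + ∑ i, |p i|) := by
  have h1 : |∑ i, b i * p i| ≤ L * ∑ i, |p i| := by
    rw [Finset.mul_sum]
    refine (Finset.abs_sum_le_sum_abs _ _).trans (Finset.sum_le_sum fun i _ => ?_)
    rw [abs_mul]
    exact mul_le_mul_of_nonneg_right (hb i) (abs_nonneg _)
  have h2 : |c * z| ≤ L * |z| := by
    rw [abs_mul]
    exact mul_le_mul_of_nonneg_right hc (abs_nonneg _)
  have := abs_add_le (∑ i, b i * p i) (c * z)
  linarith

theorem ell_add (dz : ℝ) (dp : Fin n → ℝ) : P.ell x (z + dz) (p + dp) α β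
    = P.ell x z p α β + ((∑ i, P.b i x α β * dp i) + P.c x α β * dz) := by
  simp only [ell, Pi.add_apply, mul_add, Finset.sum_add_distrib]
  ring

theorem BoundedAt.abs_linear_le (hK : P.BoundedAt x K) (dz : ℝ) (dp : Fin n → ℝ) (α : A) (β : B) :
    |(∑ i, P.b i x α β * dp i) + P.c x α β * dz| ≤ K * (|dz| + ∑ i, |dp i|) :=
  abs_sum_mul_add_mul_le (hK α β).1 (hK α β).2.1

theorem BoundedAt.abs_ell_le (hK : P.BoundedAt x K) (z : ℝ) (p : Fin n → ℝ) (α : A) (β : B) :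
    |P.ell x z p α β| ≤ K * (|z| + ∑ i, |p i|) + K := by
  have h := abs_sub ((∑ i, P.b i x α β * p i) + P.c x α β * z) (P.f x α β)
  exact h.trans (add_le_add (hK.abs_linear_le z p α β) (hK α β).2.2)

theorem IsArgmin.innerMin_eq (h : P.IsArgmin x z p α β) : P.innerMin x z p α = P.ell x z p α β :=
  haveI : Nonempty B := ⟨β⟩
  le_antisymm (ciInf_le ⟨_, by rintro _ ⟨β', rfl⟩; exact h β'⟩ β) (le_ciInf h)

theorem IsArgmax.hamiltonian_eq (h : P.IsArgmax x z p α) :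
    P.hamiltonian x z p = P.innerMin x z p α :=
  haveI : Nonempty A := ⟨α⟩
  le_antisymm (ciSup_le h) (le_ciSup ⟨_, by rintro _ ⟨α', rfl⟩; exact h α'⟩ α)

theorem exists_isArgmax [Finite A] [Nonempty A] (z : ℝ) (p : Fin n → ℝ) :
    ∃ α, P.IsArgmax x z p α :=
  Finite.exists_max _

theorem innerMin_le_hamiltonian [Finite A] (z : ℝ) (p : Fin n → ℝ) (α : A) :
    P.innerMin x z p α ≤ P.hamiltonian x z p :=
  le_ciSup (Set.finite_range _).bddAbove α

/-- The remainder of the generalised linearisation at `(z + dz, p + dp)` in terms of `ℓ`. -/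
theorem hamiltonian_remainder_eq {dz : ℝ} {dp : Fin n → ℝ}
    (hα : P.IsArgmax x (z + dz) (p + dp) α) (hβ : P.IsArgmin x (z + dz) (p + dp) α β) :
    P.hamiltonian x (z + dz) (p + dp) - P.hamiltonian x z p
      - ((∑ i, P.b i x α β * dp i) + P.c x α β * dz) = P.ell x z p α β - P.hamiltonian x z p := by
  rw [hα.hamiltonian_eq, hβ.innerMin_eq, ell_add]
  ring

variable [TopologicalSpace B]

/-- `ℓ(x, ·)` is continuous in `β`. -/
structure ContinuousCoeffAt (P : HJBIData n A B) (x : EuclideanSpace ℝ (Fin n)) : Prop where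
  b_continuous : ∀ i α, Continuous (P.b i x α)
  c_continuous : ∀ α, Continuous (P.c x α)
  f_continuous : ∀ α, Continuous (P.f x α)

theorem ContinuousCoeffAt.continuous_ell (h : P.ContinuousCoeffAt x) (z : ℝ) (p : Fin n → ℝ) (α : A) :
    Continuous (P.ell x z p α) :=
  ((continuous_finsetSum _ fun i _ => (h.b_continuous i α).mul continuous_const).add
    ((h.c_continuous α).mul continuous_const)).sub (h.f_continuous α)

variable [CompactSpace B] [Nonempty B]

theorem ContinuousCoeffAt.exists_isArgmin (h : P.ContinuousCoeffAt x) (z : ℝ) (p : Fin n → ℝ)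
    (α : A) : ∃ β, P.IsArgmin x z p α β :=
  let ⟨β, hβ, _⟩ := exists_forall_le_of_continuous (h.continuous_ell z p α)
  ⟨β, hβ⟩

theorem ContinuousCoeffAt.innerMin_le (h : P.ContinuousCoeffAt x) (z : ℝ) (p : Fin n → ℝ)
    (α : A) (β : B) : P.innerMin x z p α ≤ P.ell x z p α β := by
  obtain ⟨β', hβ'⟩ := h.exists_isArgmin z p α
  rw [hβ'.innerMin_eq]
  exact hβ' β

/-- Each minimum is tested with the minimiser of the other, as for any infimum of functions with a
common Lipschitz constant. -/
theorem BoundedAt.abs_innerMin_sub_le (hK : P.BoundedAt x K) (h : P.ContinuousCoeffAt x)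
    (z : ℝ) (p : Fin n → ℝ) (dz : ℝ) (dp : Fin n → ℝ) (α : A) :
    |P.innerMin x (z + dz) (p + dp) α - P.innerMin x z p α| ≤ K * (|dz| + ∑ i, |dp i|) := by
  obtain ⟨β₁, h₁⟩ := h.exists_isArgmin z p α
  obtain ⟨β₂, h₂⟩ := h.exists_isArgmin (z + dz) (p + dp) α
  have e₁ := h.innerMin_le z p α β₂
  have e₂ := h.innerMin_le (z + dz) (p + dp) α β₁
  have l₁ := abs_le.1 (hK.abs_linear_le dz dp α β₁)
  have l₂ := abs_le.1 (hK.abs_linear_le dz dp α β₂)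
  rw [h₁.innerMin_eq] at e₁ ⊢
  rw [h₂.innerMin_eq] at e₂ ⊢
  rw [ell_add] at e₂ ⊢
  rw [ell_add] at e₂
  exact abs_le.2 ⟨by linarith, by linarith⟩

/-- For a fixed outer control, `min_β ℓ` is semismooth: the inner minimisers at nearby points give
almost minimal values, up to an error of higher order. -/
theorem BoundedAt.eventually_ell_sub_innerMin_le (hK : P.BoundedAt x K)
    (h : P.ContinuousCoeffAt x) (z : ℝ) (p : Fin n → ℝ) (α : A) {ε : ℝ} (hε : 0 < ε) :
    ∃ δ > 0, ∀ (dz : ℝ) (dp : Fin n → ℝ), |dz| + ∑ i, |dp i| < δ →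
      ∀ β, P.IsArgmin x (z + dz) (p + dp) α β →
        P.ell x z p α β - P.innerMin x z p α ≤ ε * (|dz| + ∑ i, |dp i|) := by
  -- The controls whose coefficients are `ε`-close to those of some exact minimiser at `(z, p)`.
  let O : Set B := ⋃ β' ∈ {β' | P.IsArgmin x z p α β'},
    {β | (∀ i, |P.b i x α β' - P.b i x α β| < ε) ∧ |P.c x α β' - P.c x α β| < ε}
  have hO : IsOpen O := by
    refine isOpen_biUnion fun β' _ => ?_
    have h1 : ∀ i, IsOpen {β | |P.b i x α β' - P.b i x α β| < ε} := fun i =>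
      isOpen_lt ((continuous_const.sub (h.b_continuous i α)).abs) continuous_const
    have h2 : IsOpen {β | |P.c x α β' - P.c x α β| < ε} :=
      isOpen_lt ((continuous_const.sub (h.c_continuous α)).abs) continuous_const
    have h3 := (isOpen_iInter_of_finite h1).inter h2
    convert h3 using 1
    ext β
    simp
  -- Outside the open set `O`, `ℓ` attains its minimum by compactness, and not at a minimiser, so
  -- there is a positive gap.
  obtain ⟨δ, hδ, hgap⟩ : ∃ δ > 0, ∀ β ∉ O, P.innerMin x z p α + δ ≤ P.ell x z p α β := by
    rcases (Oᶜ).eq_empty_or_nonempty with hemp | hne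
    · exact ⟨1, one_pos, fun β hβ => absurd (show β ∈ Oᶜ from hβ) (by simp [hemp])⟩
    · obtain ⟨β₀, hβ₀, hmin⟩ := hO.isClosed_compl.isCompact.exists_isMinOn hne
        (h.continuous_ell z p α).continuousOn
      have hlt : P.innerMin x z p α < P.ell x z p α β₀ := by
        refine lt_of_le_of_ne (h.innerMin_le z p α β₀) fun heq => hβ₀ ?_
        refine mem_biUnion (x := β₀) (fun β' => ?_) ⟨fun i => by simpa using hε, by simpa using hε⟩
        rw [← heq]
        exact h.innerMin_le z p α β'
      exact ⟨P.ell x z p α β₀ - P.innerMin x z p α, sub_pos.2 hlt, fun β hβ => by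
        linarith [isMinOn_iff.1 hmin β hβ]⟩
  -- The value of `ℓ` at `β` and the minimum each move by at most `K * σ`; a total below the gap
  -- forces `β` into `O`. Using `|K| + 1` keeps the divisor positive.
  have hK1 : 0 < 2 * (|K| + 1) := by positivity
  refine ⟨δ / (2 * (|K| + 1)), by positivity, fun dz dp hs β hβ => ?_⟩
  set σ := |dz| + ∑ i, |dp i| with hσ
  have hσ0 : 0 ≤ σ := add_nonneg (abs_nonneg _) (Finset.sum_nonneg fun i _ => abs_nonneg _)
  rw [lt_div_iff₀ hK1] at hs
  have hm := abs_le.1 (hK.abs_innerMin_sub_le h z p dz dp α)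
  have hl := abs_le.1 (hK.abs_linear_le dz dp α β)
  rw [hβ.innerMin_eq, ell_add] at hm
  have hβO : β ∈ O := by
    by_contra hβO
    have := hgap β hβO
    nlinarith [le_abs_self K]
  -- Optimality of `β` against `β'` at the shifted point bounds the loss at `(z, p)` by the
  -- difference of the two linear parts, whose coefficients are `ε`-close.
  obtain ⟨β', hβ', hb, hc⟩ := mem_iUnion₂.1 hβO
  have h1 := hβ β'
  rw [ell_add, ell_add] at h1
  have h2 := (abs_le.1 (abs_sum_mul_add_mul_le (p := dp) (z := dz)
    (b := fun i => P.b i x α β' - P.b i x α β) (c := P.c x α β' - P.c x α β)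
    (fun i => (hb i).le) hc.le)).2
  simp only [sub_mul, Finset.sum_sub_distrib] at h2
  rw [IsArgmin.innerMin_eq hβ']
  linarith

variable [Finite A] [Nonempty A]

theorem BoundedAt.abs_hamiltonian_sub_le (hK : P.BoundedAt x K) (h : P.ContinuousCoeffAt x)
    (z : ℝ) (p : Fin n → ℝ) (dz : ℝ) (dp : Fin n → ℝ) :
    |P.hamiltonian x (z + dz) (p + dp) - P.hamiltonian x z p| ≤ K * (|dz| + ∑ i, |dp i|) := by
  obtain ⟨α₁, h₁⟩ := P.exists_isArgmax (x := x) z p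
  obtain ⟨α₂, h₂⟩ := P.exists_isArgmax (x := x) (z + dz) (p + dp)
  have e₁ := P.innerMin_le_hamiltonian (x := x) z p α₂
  have e₂ := P.innerMin_le_hamiltonian (x := x) (z + dz) (p + dp) α₁
  have l₁ := abs_le.1 (hK.abs_innerMin_sub_le h z p dz dp α₁)
  have l₂ := abs_le.1 (hK.abs_innerMin_sub_le h z p dz dp α₂)
  have g₁ := h₁.hamiltonian_eq
  have g₂ := h₂.hamiltonian_eq
  exact abs_le.2 ⟨by linarith, by linarith⟩

theorem BoundedAt.abs_hamiltonian_le (hK : P.BoundedAt x K) (h : P.ContinuousCoeffAt x)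
    (z : ℝ) (p : Fin n → ℝ) :
    |P.hamiltonian x z p| ≤ K * (|z| + ∑ i, |p i|) + K := by
  obtain ⟨α, hα⟩ := P.exists_isArgmax (x := x) z p
  obtain ⟨β, hβ⟩ := h.exists_isArgmin z p α
  rw [hα.hamiltonian_eq, hβ.innerMin_eq]
  exact hK.abs_ell_le z p α β

/-- Pointwise semismoothness of the Hamiltonian. -/
theorem BoundedAt.exists_abs_ell_sub_hamiltonian_le (hK : P.BoundedAt x K)
    (h : P.ContinuousCoeffAt x) (z : ℝ) (p : Fin n → ℝ) {ε : ℝ} (hε : 0 < ε) :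
    ∃ δ > 0, ∀ (dz : ℝ) (dp : Fin n → ℝ), |dz| + ∑ i, |dp i| < δ →
      ∀ α β, P.IsArgmax x (z + dz) (p + dp) α → P.IsArgmin x (z + dz) (p + dp) α β →
        |P.ell x z p α β - P.hamiltonian x z p| ≤ ε * (|dz| + ∑ i, |dp i|) := by
  -- The radius may depend on `α`, since the least of finitely many radii is positive.
  have hall : ∀ α, ∃ δ > 0, ∀ (dz : ℝ) (dp : Fin n → ℝ), |dz| + ∑ i, |dp i| < δ →
      ∀ β, P.IsArgmax x (z + dz) (p + dp) α → P.IsArgmin x (z + dz) (p + dp) α β →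
        |P.ell x z p α β - P.hamiltonian x z p| ≤ ε * (|dz| + ∑ i, |dp i|) := by
    intro α
    by_cases hα : P.IsArgmax x z p α
    · obtain ⟨δ, hδ, hδ'⟩ := hK.eventually_ell_sub_innerMin_le h z p α hε
      refine ⟨δ, hδ, fun dz dp hs β _ hβ => ?_⟩
      rw [hα.hamiltonian_eq, abs_of_nonneg (sub_nonneg.2 (h.innerMin_le z p α β))]
      exact hδ' dz dp hs β hβ
    -- A strictly suboptimal `α` cannot be optimal within this radius, so the hypotheses are
    -- contradictory here.
    · have hlt : P.innerMin x z p α < P.hamiltonian x z p := by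
        refine lt_of_le_of_ne (P.innerMin_le_hamiltonian z p α) fun heq => hα fun α' => ?_
        rw [heq]
        exact P.innerMin_le_hamiltonian z p α'
      have hK1 : 0 < 2 * (|K| + 1) := by positivity
      refine ⟨(P.hamiltonian x z p - P.innerMin x z p α) / (2 * (|K| + 1)),
        div_pos (sub_pos.2 hlt) hK1, fun dz dp hs β hα' _ => ?_⟩
      rw [lt_div_iff₀ hK1] at hs
      have hσ0 : 0 ≤ |dz| + ∑ i, |dp i| :=
        add_nonneg (abs_nonneg _) (Finset.sum_nonneg fun i _ => abs_nonneg _)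
      have h1 := abs_le.1 (hK.abs_innerMin_sub_le h z p dz dp α)
      have h2 := abs_le.1 (hK.abs_hamiltonian_sub_le h z p dz dp)
      have h3 := hα'.hamiltonian_eq
      nlinarith [le_abs_self K]
  choose δ hδ hδ' using hall
  obtain ⟨α₀, hα₀⟩ := Finite.exists_min δ
  exact ⟨δ α₀, hδ α₀, fun dz dp hs α β => hδ' α dz dp (hs.trans_le (hα₀ α)) β⟩

theorem BoundedAt.abs_hamiltonian_remainder_le (hK : P.BoundedAt x K) (h : P.ContinuousCoeffAt x)
    (z : ℝ) (p : Fin n → ℝ) (dz : ℝ) (dp : Fin n → ℝ) (α : A) (β : B) :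
    |P.hamiltonian x (z + dz) (p + dp) - P.hamiltonian x z p
      - ((∑ i, P.b i x α β * dp i) + P.c x α β * dz)| ≤ 2 * K * (|dz| + ∑ i, |dp i|) := by
  have h1 := abs_sub (P.hamiltonian x (z + dz) (p + dp) - P.hamiltonian x z p)
    ((∑ i, P.b i x α β * dp i) + P.c x α β * dz)
  have h2 := hK.abs_hamiltonian_sub_le h z p dz dp
  have h3 := hK.abs_linear_le dz dp α β
  linarith

end pointwise

end HJBIData

/-! ### Measurability of controlled coefficients -/

section coefficients

variable {n : ℕ} {Ω : Set (EuclideanSpace ℝ (Fin n))} {A B : Type*} [TopologicalSpace B]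

theorem nullMeasurableSet_restrict_self (hΩ : IsOpen Ω) :
    MeasurableSet[(inferInstance : MeasurableSpace
      (NullMeasurableSpace (EuclideanSpace ℝ (Fin n)) (volume.restrict Ω)))] Ω :=
  hΩ.measurableSet.nullMeasurableSet

/-- Continuity in `β` is assumed only over `Ω`; extension by zero gives a Carathéodory function on
the whole space. -/
theorem IsAdmissibleCoeff.continuous_indicator {φ : EuclideanSpace ℝ (Fin n) → A → B → ℝ}
    (hφ : IsAdmissibleCoeff Ω φ) (x : EuclideanSpace ℝ (Fin n)) (α : A) :
    Continuous fun β => Ω.indicator (fun y => φ y α β) x := by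
  by_cases hx : x ∈ Ω
  · simpa [hx] using hφ.continuous x hx α
  · simpa [hx] using continuous_const

/-- A Carathéodory function is jointly measurable, so measurable controls may be substituted. The
finite variable `α` is treated fibre by fibre. -/
theorem IsAdmissibleCoeff.nullMeasurable_comp [CompactSpace B] [TopologicalSpace.MetrizableSpace B]
    [MeasurableSpace B] [BorelSpace B] [Finite A] [MeasurableSpace A] [DiscreteMeasurableSpace A]
    (hΩ : IsOpen Ω) {φ : EuclideanSpace ℝ (Fin n) → A → B → ℝ} (hφ : IsAdmissibleCoeff Ω φ)
    {α : EuclideanSpace ℝ (Fin n) → A} {β : EuclideanSpace ℝ (Fin n) → B}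
    (hα : NullMeasurable α (volume.restrict Ω)) (hβ : NullMeasurable β (volume.restrict Ω)) :
    NullMeasurable (fun x => φ x (α x) (β x)) (volume.restrict Ω) := by
  let X := NullMeasurableSpace (EuclideanSpace ℝ (Fin n)) (volume.restrict Ω)
  let _ := TopologicalSpace.metrizableSpaceMetric B
  have h1 : ∀ a : A, Measurable
      (Function.uncurry fun (b : B) (x : X) => Ω.indicator (fun y => φ y a b) x) := fun a =>
    measurable_uncurry_of_continuous_of_measurable (fun x => hφ.continuous_indicator x a)
      fun b => (hφ.measurable a b).measurable'.indicator (nullMeasurableSet_restrict_self hΩ)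
  have h2 : Measurable fun q : X × A => Ω.indicator (fun y => φ y q.2 (β q.1)) q.1 :=
    measurable_from_prod_countable_left fun a =>
      (h1 a).comp (hβ.measurable'.prodMk measurable_id)
  have h3 : Measurable fun x : X => Ω.indicator (fun y => φ y (α x) (β x)) x :=
    h2.comp (measurable_id.prodMk hα.measurable')
  have h4 : NullMeasurable (fun x => Ω.indicator (fun y => φ y (α x) (β x)) x) (volume.restrict Ω) :=
    h3
  refine h4.congr ?_
  filter_upwards [ae_restrict_mem hΩ.measurableSet] with x hx
  rw [indicator_of_mem hx]

end coefficients

/-! ### Measurable selection of optimal controls -/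

namespace HJBIData

section controls

variable {n : ℕ} {Ω : Set (EuclideanSpace ℝ (Fin n))} {A B : Type*} [TopologicalSpace B]
  {P : HJBIData n A B}

theorem IsAdmissible.continuousCoeffAt (hP : P.IsAdmissible Ω) {x : EuclideanSpace ℝ (Fin n)}
    (hx : x ∈ Ω) : P.ContinuousCoeffAt x :=
  ⟨fun i α => (hP.b_coeff i).continuous x hx α, fun α => hP.c_coeff.continuous x hx α,
    fun α => hP.f_coeff.continuous x hx α⟩

theorem IsAdmissible.exists_boundedAt (hP : P.IsAdmissible Ω) :
    ∃ K, 0 ≤ K ∧ ∀ᵐ x ∂volume.restrict Ω, P.BoundedAt x K := by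
  choose Kb hKb using fun i => (hP.b_coeff i).bounded
  obtain ⟨Kc, hKc⟩ := hP.c_coeff.bounded
  obtain ⟨Kf, hKf⟩ := hP.f_coeff.bounded
  have hb0 : 0 ≤ ∑ i, |Kb i| := Finset.sum_nonneg fun i _ => abs_nonneg _
  refine ⟨(∑ i, |Kb i|) + |Kc| + |Kf|, by positivity, ?_⟩
  filter_upwards [ae_all_iff.2 hKb, hKc, hKf] with x h1 h2 h3 α β
  refine ⟨fun i => ?_, ?_, ?_⟩
  · have := Finset.single_le_sum (f := fun i => |Kb i|) (fun i _ => abs_nonneg _) (Finset.mem_univ i)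
    linarith [h1 i α β, le_abs_self (Kb i), abs_nonneg Kc, abs_nonneg Kf]
  · linarith [h2 α β, le_abs_self Kc, abs_nonneg Kf]
  · linarith [h3 α β, le_abs_self Kf, abs_nonneg Kc]

theorem IsAdmissible.nullMeasurable_ell (hP : P.IsAdmissible Ω) {v : EuclideanSpace ℝ (Fin n) → ℝ}
    {p : EuclideanSpace ℝ (Fin n) → Fin n → ℝ} (hv : NullMeasurable v (volume.restrict Ω))
    (hp : ∀ i, NullMeasurable (fun x => p x i) (volume.restrict Ω)) (α : A) (β : B) :
    NullMeasurable (fun x => P.ell x (v x) (p x) α β) (volume.restrict Ω) :=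
  ((Finset.measurable_fun_sum _ fun i _ =>
    ((hP.b_coeff i).measurable α β).measurable'.mul (hp i).measurable').add
    ((hP.c_coeff.measurable α β).measurable'.mul hv.measurable')).sub
    (hP.f_coeff.measurable α β).measurable'

theorem IsAdmissible.continuous_indicator_ell (hP : P.IsAdmissible Ω)
    (v : EuclideanSpace ℝ (Fin n) → ℝ) (p : EuclideanSpace ℝ (Fin n) → Fin n → ℝ)
    (x : EuclideanSpace ℝ (Fin n)) (α : A) :
    Continuous fun β => Ω.indicator (fun y => P.ell y (v y) (p y) α β) x := by
  by_cases hx : x ∈ Ω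
  · simpa [hx] using (hP.continuousCoeffAt hx).continuous_ell (v x) (p x) α
  · simpa [hx] using continuous_const

variable [CompactSpace B] [Nonempty B] [TopologicalSpace.MetrizableSpace B]

theorem IsAdmissible.nullMeasurable_innerMin (hΩ : IsOpen Ω) (hP : P.IsAdmissible Ω)
    {v : EuclideanSpace ℝ (Fin n) → ℝ}
    {p : EuclideanSpace ℝ (Fin n) → Fin n → ℝ} (hv : NullMeasurable v (volume.restrict Ω))
    (hp : ∀ i, NullMeasurable (fun x => p x i) (volume.restrict Ω)) (α : A) :
    NullMeasurable (fun x => P.innerMin x (v x) (p x) α) (volume.restrict Ω) := by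
  let _ := TopologicalSpace.metrizableSpaceMetric B
  have h : NullMeasurable (fun x => ⨅ β, Ω.indicator (fun y => P.ell y (v y) (p y) α β) x)
      (volume.restrict Ω) :=
    measurable_iInf_of_continuous
      (X := NullMeasurableSpace (EuclideanSpace ℝ (Fin n)) (volume.restrict Ω))
      (fun β => (hP.nullMeasurable_ell hv hp α β).measurable'.indicator
        (nullMeasurableSet_restrict_self hΩ)) fun x => hP.continuous_indicator_ell v p x α
  refine h.congr ?_
  filter_upwards [ae_restrict_mem hΩ.measurableSet] with x hx
  simp [hx, innerMin]

theorem IsAdmissible.nullMeasurable_hamiltonian [Finite A] (hΩ : IsOpen Ω) (hP : P.IsAdmissible Ω)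
    {v : EuclideanSpace ℝ (Fin n) → ℝ}
    {p : EuclideanSpace ℝ (Fin n) → Fin n → ℝ} (hv : NullMeasurable v (volume.restrict Ω))
    (hp : ∀ i, NullMeasurable (fun x => p x i) (volume.restrict Ω)) :
    NullMeasurable (fun x => P.hamiltonian x (v x) (p x)) (volume.restrict Ω) :=
  Measurable.iSup fun α => (hP.nullMeasurable_innerMin hΩ hv hp α).measurable'

/-- Measurable selection of outer maximisers. -/
theorem IsAdmissible.exists_measurable_isArgmax [Finite A] [Nonempty A]
    [MeasurableSpace A] [DiscreteMeasurableSpace A] (hΩ : IsOpen Ω) (hP : P.IsAdmissible Ω)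
    {v : EuclideanSpace ℝ (Fin n) → ℝ}
    {p : EuclideanSpace ℝ (Fin n) → Fin n → ℝ} (hv : NullMeasurable v (volume.restrict Ω))
    (hp : ∀ i, NullMeasurable (fun x => p x i) (volume.restrict Ω)) :
    ∃ α : EuclideanSpace ℝ (Fin n) → A, NullMeasurable α (volume.restrict Ω) ∧
      ∀ x, P.IsArgmax x (v x) (p x) (α x) := by
  -- With the discrete topology the finite set `A` is compact and metrizable, so the selection
  -- theorem for minimisers applies to `-innerMin`.
  let _ : TopologicalSpace A := ⊥
  have : DiscreteTopology A := ⟨rfl⟩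
  have : BorelSpace A := ⟨by
    ext s
    exact ⟨fun _ => MeasurableSpace.measurableSet_generateFrom (isOpen_discrete s), fun _ => .of_discrete⟩⟩
  obtain ⟨α, hα, hα'⟩ := exists_measurable_argmin
    (X := NullMeasurableSpace (EuclideanSpace ℝ (Fin n)) (volume.restrict Ω))
    (f := fun x α => -P.innerMin x (v x) (p x) α)
    (fun α => (hP.nullMeasurable_innerMin hΩ hv hp α).measurable'.neg)
    fun x => continuous_of_discreteTopology
  exact ⟨α, hα, fun x α' => neg_le_neg_iff.1 (hα' x α')⟩

variable [MeasurableSpace B] [BorelSpace B]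

/-- Measurable selection of inner minimisers. -/
theorem IsAdmissible.exists_measurable_isArgmin (hΩ : IsOpen Ω) (hP : P.IsAdmissible Ω)
    {v : EuclideanSpace ℝ (Fin n) → ℝ}
    {p : EuclideanSpace ℝ (Fin n) → Fin n → ℝ} (hv : NullMeasurable v (volume.restrict Ω))
    (hp : ∀ i, NullMeasurable (fun x => p x i) (volume.restrict Ω)) :
    ∃ β : EuclideanSpace ℝ (Fin n) → A → B,
      (∀ α, NullMeasurable (fun x => β x α) (volume.restrict Ω)) ∧
      ∀ x ∈ Ω, ∀ α, P.IsArgmin x (v x) (p x) α (β x α) := by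
  have h : ∀ α, ∃ β : NullMeasurableSpace (EuclideanSpace ℝ (Fin n)) (volume.restrict Ω) → B,
      Measurable β ∧ ∀ x b, Ω.indicator (fun y => P.ell y (v y) (p y) α (β x)) x
        ≤ Ω.indicator (fun y => P.ell y (v y) (p y) α b) x := fun α =>
    exists_measurable_argmin (fun β => (hP.nullMeasurable_ell hv hp α β).measurable'.indicator
        (nullMeasurableSet_restrict_self hΩ)) fun x => hP.continuous_indicator_ell v p x α
  choose β hβ hβ' using h
  refine ⟨fun x α => β α x, fun α => hβ α, fun x hx α b => ?_⟩
  simpa [hx] using hβ' α x b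

end controls

end HJBIData

theorem H2.IsRepresentative.nullMeasurable {n : ℕ} {Ω : Set (EuclideanSpace ℝ (Fin n))} {u : H2 Ω}
    {v : EuclideanSpace ℝ (Fin n) → ℝ} {p : EuclideanSpace ℝ (Fin n) → Fin n → ℝ}
    (h : u.IsRepresentative v p) : NullMeasurable v (volume.restrict Ω) ∧
      ∀ i, NullMeasurable (fun x => p x i) (volume.restrict Ω) :=
  ⟨(Lp.stronglyMeasurable u.val).measurable.nullMeasurable.congr h.1.symm,
    fun i => (Lp.stronglyMeasurable (u.grad i)).measurable.nullMeasurable.congr (h.2 i).symm⟩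

namespace HJBIData

theorem IsJointFeedback.nullMeasurable_comp {n : ℕ} {Ω : Set (EuclideanSpace ℝ (Fin n))}
    {A B : Type*} [MeasurableSpace A] [MeasurableSpace B] {P : HJBIData n A B}
    {v : EuclideanSpace ℝ (Fin n) → ℝ} {p : EuclideanSpace ℝ (Fin n) → Fin n → ℝ}
    {α : EuclideanSpace ℝ (Fin n) → A} {β : EuclideanSpace ℝ (Fin n) → A → B}
    {α' : EuclideanSpace ℝ (Fin n) → A}
    (h : P.IsJointFeedback Ω v p α β) (hα' : NullMeasurable α' (volume.restrict Ω)) :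
    NullMeasurable (fun x => β x (α' x)) (volume.restrict Ω) :=
  h.measurable_min.comp (measurable_id.prodMk hα'.measurable')

/-! ### Passing between the two kinds of feedback -/

section feedback

variable {n : ℕ} {Ω : Set (EuclideanSpace ℝ (Fin n))} {A B : Type*} [TopologicalSpace B]
  {P : HJBIData n A B} [CompactSpace B] [Nonempty B] [TopologicalSpace.MetrizableSpace B]
  [MeasurableSpace B] [Finite A] [MeasurableSpace A]
  [DiscreteMeasurableSpace A] {u : H2 Ω} {v : EuclideanSpace ℝ (Fin n) → ℝ}
  {p : EuclideanSpace ℝ (Fin n) → Fin n → ℝ} {α : EuclideanSpace ℝ (Fin n) → A}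

/-- The given `β` is kept on the graph of `α`, and a measurable minimiser is used off it;
measurability is checked for each of the finitely many outer controls. -/
theorem IsFeedback.exists_isJointFeedback [BorelSpace B] (hΩ : IsOpen Ω) (hP : P.IsAdmissible Ω)
    (h : u.IsRepresentative v p) {β : EuclideanSpace ℝ (Fin n) → B} (hf : P.IsFeedback Ω v p α β) :
    ∃ β' : EuclideanSpace ℝ (Fin n) → A → B, (∀ x, β' x (α x) = β x) ∧
      P.IsJointFeedback Ω v p α β' := by
  classical
  obtain ⟨β₀, hβ₀, hβ₀'⟩ := hP.exists_measurable_isArgmin hΩ h.nullMeasurable.1 h.nullMeasurable.2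
  refine ⟨fun x a => if α x = a then β x else β₀ x a, fun x => if_pos rfl, hf.measurable_max, ?_, ?_, ?_⟩
  · refine measurable_from_prod_countable_left fun a => ?_
    exact Measurable.ite (hf.measurable_max.measurable' (measurableSet_singleton a))
      hf.measurable_min.measurable' (hβ₀ a).measurable'
  · filter_upwards [ae_restrict_mem hΩ.measurableSet] with x hx
    exact hf.isArgmax x hx
  · intro x hx a
    by_cases ha : α x = a
    · subst ha
      simpa using hf.isArgmin x hx
    · simpa [ha] using hβ₀' x hx a

variable [Nonempty A]

theorem IsAdmissible.exists_isJointFeedback [BorelSpace B] (hΩ : IsOpen Ω) (hP : P.IsAdmissible Ω)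
    (h : u.IsRepresentative v p) : ∃ α β, P.IsJointFeedback Ω v p α β := by
  obtain ⟨β, hβ, hβ'⟩ := hP.exists_measurable_isArgmin hΩ h.nullMeasurable.1 h.nullMeasurable.2
  obtain ⟨α, hα, hα'⟩ := hP.exists_measurable_isArgmax hΩ h.nullMeasurable.1 h.nullMeasurable.2
  exact ⟨α, β, hα, measurable_from_prod_countable_left hβ, Eventually.of_forall hα', hβ'⟩

/-- A joint feedback yields a feedback with, almost everywhere, the same controls. -/
theorem IsJointFeedback.exists_isFeedback (hΩ : IsOpen Ω) (hP : P.IsAdmissible Ω)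
    (h : u.IsRepresentative v p) {β : EuclideanSpace ℝ (Fin n) → A → B}
    (hj : P.IsJointFeedback Ω v p α β) :
    ∃ α', α' =ᵐ[volume.restrict Ω] α ∧ P.IsFeedback Ω v p α' fun x => β x (α' x) := by
  classical
  obtain ⟨α₀, -, hα₀⟩ := hP.exists_measurable_isArgmax hΩ h.nullMeasurable.1 h.nullMeasurable.2
  -- `α` is altered only on the null set where it fails to be optimal, so null measurability
  -- survives.
  let α' : EuclideanSpace ℝ (Fin n) → A := fun x =>
    if P.IsArgmax x (v x) (p x) (α x) then α x else α₀ x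
  have he : α' =ᵐ[volume.restrict Ω] α := by
    filter_upwards [hj.isArgmax] with x hx
    exact if_pos hx
  have hm : NullMeasurable α' (volume.restrict Ω) := hj.measurable_max.congr he.symm
  refine ⟨α', he, hm, hj.nullMeasurable_comp hm, fun x _ => ?_, fun x hx => hj.isArgmin x hx _⟩
  by_cases hx : P.IsArgmax x (v x) (p x) (α x)
  · simpa only [α', if_pos hx] using hx
  · simpa only [α', if_neg hx] using hα₀ x

/-- A controlled operator depends only on the a.e. values of the coefficients along the controls,
which both passages preserve. -/
theorem jointDifferential_eq_feedbackDifferential [BorelSpace B] (hΩ : IsOpen Ω) (hP : P.IsAdmissible Ω)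
    (u : H2 Ω) : P.jointDifferential u = P.feedbackDifferential u := by
  ext M
  constructor
  · rintro ⟨v, p, α, β, hr, hj, hM⟩
    obtain ⟨α', he, hf⟩ := hj.exists_isFeedback hΩ hP hr
    refine ⟨v, p, α', _, hr, hf, fun w => ?_⟩
    filter_upwards [hM w, he] with x hx hx'
    rw [hx, hx']
  · rintro ⟨v, p, α, β, hr, hf, hM⟩
    obtain ⟨β', he, hj⟩ := hf.exists_isJointFeedback hΩ hP hr
    refine ⟨v, p, α, β', hr, hj, fun w => ?_⟩
    filter_upwards [hM w] with x hx
    rw [hx, he]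

end feedback

end HJBIData

/-! ### Bounds in `L²(Ω)` -/

section multiplication

variable {X : Type*} [MeasurableSpace X] {μ : Measure X}

/-- Multiplication by an essentially bounded function. -/
theorem exists_clm_mul {φ : X → ℝ} (hφ : AEMeasurable φ μ) {K : ℝ} (hK : ∀ᵐ x ∂μ, |φ x| ≤ K) :
    ∃ T : Lp ℝ 2 μ →L[ℝ] Lp ℝ 2 μ, ∀ w, T w =ᵐ[μ] fun x => φ x * w x := by
  have hm : MemLp φ ⊤ μ := memLp_top_of_bound hφ.aestronglyMeasurable K hK
  -- Hölder's inequality for the product of `L^∞` and `L²`.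
  refine ⟨(ContinuousLinearMap.mul ℝ ℝ).holderL μ ⊤ 2 2 (hm.toLp φ), fun w => ?_⟩
  have h := (ContinuousLinearMap.mul ℝ ℝ).coeFn_holder (r := 2) (hm.toLp φ) w
  filter_upwards [h, hm.coeFn_toLp] with x hx hx'
  rw [← hx']
  exact hx

end multiplication

/-! ### Higher-order remainders in `L²` through equi-integrability -/

namespace H2

variable {n : ℕ} {Ω : Set (EuclideanSpace ℝ (Fin n))}

/-- The evaluation of a derivative as a continuous linear map. -/
noncomputable def derivL (k : JetIndex n) : H2 Ω →L[ℝ] L2 Ω :=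
  (PiLp.proj 2 (fun _ : JetIndex n => L2 Ω) k).comp (h2Submodule Ω).subtypeL

theorem norm_val_le (u : H2 Ω) : ‖u.val‖ ≤ ‖u‖ := PiLp.norm_apply_le (u : Jet Ω) _

theorem norm_grad_le (u : H2 Ω) (i : Fin n) : ‖u.grad i‖ ≤ ‖u‖ := PiLp.norm_apply_le (u : Jet Ω) _

theorem norm_hess_le (u : H2 Ω) (i j : Fin n) : ‖u.hess i j‖ ≤ ‖u‖ :=
  PiLp.norm_apply_le (u : Jet Ω) _

/-- The function `|u| + ∑ᵢ |∂ᵢu|`. -/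
noncomputable def size (u : H2 Ω) : L2 Ω := |u.val| + ∑ i, |u.grad i|

theorem coeFn_size (u : H2 Ω) :
    u.size =ᵐ[volume.restrict Ω] fun x => |u.val x| + ∑ i, |u.grad i x| := by
  filter_upwards [Lp.coeFn_add |u.val| (∑ i, |u.grad i|), Lp.coeFn_abs u.val,
    Lp.coeFn_finsetSum Finset.univ fun i => |u.grad i|,
    ae_all_iff.2 fun i => Lp.coeFn_abs (u.grad i)] with x h1 h2 h3 h4
  rw [size, h1, Pi.add_apply, h2, h3]
  simp only [Finset.sum_apply, h4]

theorem norm_size_le (u : H2 Ω) : ‖u.size‖ ≤ (n + 1) * ‖u‖ := by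
  refine (norm_add_le _ _).trans ?_
  have h1 : ‖∑ i, |u.grad i|‖ ≤ n * ‖u‖ := by
    refine (norm_sum_le _ _).trans ?_
    have : ∀ i ∈ Finset.univ, ‖|u.grad i|‖ ≤ ‖u‖ := fun i _ => by
      rw [norm_abs_eq_norm]
      exact u.norm_grad_le i
    simpa using Finset.sum_le_sum this
  rw [norm_abs_eq_norm]
  linarith [u.norm_val_le]

/-- Equi-integrability of `|u| + ∑ᵢ |∂ᵢu|` over the unit ball of `H²(Ω)`. -/
theorem exists_eLpNorm_size_le (hΩ : IsC11Domain Ω) {ε : ℝ} (hε : 0 < ε) :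
    ∃ δ > 0, ∀ E : Set (EuclideanSpace ℝ (Fin n)), MeasurableSet E → volume (Ω ∩ E) ≤ δ →
      ∀ u : H2 Ω, eLpNorm u.size 2 (volume.restrict (Ω ∩ E)) ≤ ENNReal.ofReal (ε * ‖u‖) := by
  set e := ε / (n + 1) with he
  have he0 : 0 < e := by positivity
  -- Applied to `u` with its gradient and to each `∂ᵢu` with its row of second derivatives: `n + 1`
  -- terms, each allotted `ε / (n + 1)`.
  obtain ⟨δ, hδ, h⟩ := hΩ.exists_lintegral_le (sq_pos_of_pos he0)
  refine ⟨δ, hδ, fun E hE hEδ u => ?_⟩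
  have key : ∀ (w : L2 Ω) (g : Fin n → L2 Ω), (∀ i, IsWeakPartial Ω i w (g i)) → ‖w‖ ≤ ‖u‖ →
      (∀ i, ‖g i‖ ≤ ‖u‖) → eLpNorm w 2 (volume.restrict (Ω ∩ E)) ≤ ENNReal.ofReal (e * ‖u‖) := by
    intro w g hg hw hgu
    have h1 := h (Ω ∩ E) (hΩ.isOpen.measurableSet.inter hE) hEδ w g ‖u‖ₑ hg
      (enorm_le_iff_norm_le.2 hw) fun i => enorm_le_iff_norm_le.2 (hgu i)
    rw [← inter_assoc, inter_self, lintegral_enorm_sq_eq, ← ofReal_norm,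
      ENNReal.ofReal_pow he0.le, ← mul_pow] at h1
    rw [ENNReal.ofReal_mul he0.le]
    exact (ENNReal.pow_le_pow_left_iff two_ne_zero).1 h1
  have hle : volume.restrict (Ω ∩ E) ≤ volume.restrict Ω :=
    Measure.restrict_mono inter_subset_left le_rfl
  have hae : u.size =ᵐ[volume.restrict (Ω ∩ E)] fun x => ‖u.val x‖ + ∑ i, ‖u.grad i x‖ :=
    u.coeFn_size.filter_mono (ae_mono hle)
  have hm : ∀ w : L2 Ω, AEStronglyMeasurable (fun x => ‖w x‖) (volume.restrict (Ω ∩ E)) :=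
    fun w => (Lp.stronglyMeasurable w).norm.aestronglyMeasurable
  calc eLpNorm u.size 2 (volume.restrict (Ω ∩ E))
      = eLpNorm ((fun x => ‖u.val x‖) + ∑ i, fun x => ‖u.grad i x‖) 2 (volume.restrict (Ω ∩ E)) := by
        refine eLpNorm_congr_ae (hae.trans (Eventually.of_forall fun x => ?_))
        simp
    _ ≤ eLpNorm (fun x => ‖u.val x‖) 2 (volume.restrict (Ω ∩ E))
          + ∑ i, eLpNorm (fun x => ‖u.grad i x‖) 2 (volume.restrict (Ω ∩ E)) := by
        refine (eLpNorm_add_le (hm _) (Finset.aestronglyMeasurable_sum _ fun i _ => hm _)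
          one_le_two).trans ?_
        gcongr
        exact eLpNorm_sum_le (fun i _ => hm _) one_le_two
    _ ≤ ENNReal.ofReal (e * ‖u‖) + ∑ _i : Fin n, ENNReal.ofReal (e * ‖u‖) := by
        simp only [eLpNorm_norm]
        gcongr with i
        · exact key _ u.grad u.2.1 u.norm_val_le u.norm_grad_le
        · exact key _ (u.hess i) (u.2.2 i) (u.norm_grad_le i) (u.norm_hess_le i)
    _ = ENNReal.ofReal (ε * ‖u‖) := by
        rw [Finset.sum_const, Finset.card_univ, Fintype.card_fin, nsmul_eq_mul,
          ← ENNReal.ofReal_natCast, ← ENNReal.ofReal_mul (by positivity),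
          ← ENNReal.ofReal_add (by positivity) (by positivity), he]
        congr 1
        field_simp
        ring

/-- Functions `R k` dominated by `|s k| + ∑ᵢ |∂ᵢ(s k)|` for a null sequence `s` in `H²(Ω)`, and of
higher order pointwise, are of higher order in `L²(Ω)` along a subsequence. -/
theorem exists_norm_le_of_pointwise (hΩ : IsC11Domain Ω) {s : ℕ → H2 Ω}
    (hs : Tendsto s atTop (𝓝 0)) {R : ℕ → L2 Ω} {K : ℝ} (hK : 0 ≤ K)
    (hbound : ∀ k, ∀ᵐ x ∂volume.restrict Ω, |R k x| ≤ K * (s k).size x)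
    (hlim : ∀ᵐ x ∂volume.restrict Ω, ∀ η > 0, ∃ δ > 0, ∀ k,
      (s k).size x < δ → |R k x| ≤ η * (s k).size x)
    {ε : ℝ} (hε : 0 < ε) : ∃ k, ‖R k‖ ≤ ε * ‖s k‖ := by
  have := hΩ.isFiniteMeasure
  have hsize : Tendsto (fun k => (s k).size) atTop (𝓝 0) := by
    refine squeeze_zero_norm (fun k => (s k).norm_size_le) ?_
    simpa using (hs.norm.const_mul ((n : ℝ) + 1))
  obtain ⟨t, ht, hta⟩ := (tendstoInMeasure_of_tendsto_Lp hsize).exists_seq_tendsto_ae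
  set η : ℝ := ε / (2 * (n + 1)) with hη
  have hη0 : 0 < η := by positivity
  -- The bad sets, where the pointwise estimate with constant `η` fails; elsewhere the contribution
  -- is at most `η * (n + 1) * ‖s k‖ = ε / 2 * ‖s k‖`.
  let E : ℕ → Set (EuclideanSpace ℝ (Fin n)) := fun k => {x | η * (s k).size x < |R k x|}
  have hEm : ∀ k, MeasurableSet (E k) := fun k =>
    measurableSet_lt ((Lp.stronglyMeasurable _).measurable.const_mul η)
      (Lp.stronglyMeasurable (R k)).norm.measurable
  -- Almost every point eventually leaves the bad sets, because `size` tends to zero there along the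
  -- subsequence; finiteness of the measure gives convergence of the measures.
  have hE : Tendsto (fun j => volume.restrict Ω (E (t j))) atTop (𝓝 0) := by
    rw [← measure_empty (μ := volume.restrict Ω)]
    refine tendsto_measure_of_ae_tendsto_indicator_of_isFiniteMeasure atTop MeasurableSet.empty
      (fun j => hEm (t j)) ?_
    filter_upwards [hlim, hta, Lp.coeFn_zero ℝ 2 (volume.restrict Ω)] with x hx hx' hx0
    obtain ⟨δ, hδ, hR⟩ := hx η hη0
    rw [hx0] at hx'
    filter_upwards [hx'.eventually (gt_mem_nhds hδ)] with j hj
    simp only [mem_empty_iff_false, iff_false]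
    exact not_lt.2 (hR _ hj)
  -- On the bad set the crude bound costs a factor `K`, and `K / (K + 1) ≤ 1` leaves `ε / 2`; the `+
  -- 1` covers `K = 0`.
  obtain ⟨δ, hδ, hsmall⟩ := exists_eLpNorm_size_le hΩ (ε := ε / (2 * (K + 1))) (by positivity)
  obtain ⟨j, hj⟩ := (hE.eventually (ge_mem_nhds hδ)).exists
  refine ⟨t j, ?_⟩
  set k := t j
  rw [Measure.restrict_apply (hEm k), inter_comm] at hj
  have h1 := hsmall (E k) (hEm k) hj (s k)
  set S : EuclideanSpace ℝ (Fin n) → ℝ := fun x => (s k).size x with hS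
  have hsm : AEStronglyMeasurable S (volume.restrict Ω) := Lp.aestronglyMeasurable _
  have hpt : ∀ᵐ x ∂volume.restrict Ω,
      ‖R k x‖ ≤ (η • S + K • (E k).indicator S) x := by
    filter_upwards [hbound k, (s k).coeFn_size] with x hx hx'
    have h0 : 0 ≤ S x := by
      change 0 ≤ (s k).size x
      rw [hx']
      exact add_nonneg (abs_nonneg _) (Finset.sum_nonneg fun i _ => abs_nonneg _)
    by_cases hxE : x ∈ E k
    · simp only [Pi.add_apply, Pi.smul_apply, smul_eq_mul, indicator_of_mem hxE, Real.norm_eq_abs]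
      nlinarith
    · simp only [Pi.add_apply, Pi.smul_apply, smul_eq_mul, indicator_of_notMem hxE, mul_zero,
        add_zero, Real.norm_eq_abs]
      exact not_lt.1 hxE
  have h2 : ‖R k‖ₑ ≤ ENNReal.ofReal (ε * ‖s k‖) := by
    rw [Lp.enorm_def]
    calc eLpNorm (R k) 2 (volume.restrict Ω)
        ≤ eLpNorm (η • S + K • (E k).indicator S) 2
            (volume.restrict Ω) := eLpNorm_mono_ae_real hpt
      _ ≤ ‖η‖ₑ * eLpNorm S 2 (volume.restrict Ω)
            + ‖K‖ₑ * eLpNorm S 2 (volume.restrict (Ω ∩ E k)) := by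
          refine (eLpNorm_add_le (hsm.const_smul η) ((hsm.indicator (hEm k)).const_smul K)
            one_le_two).trans ?_
          rw [eLpNorm_const_smul, eLpNorm_const_smul,
            eLpNorm_indicator_eq_eLpNorm_restrict (hEm k), Measure.restrict_restrict (hEm k),
            inter_comm]
      _ ≤ ENNReal.ofReal (η * ((n + 1) * ‖s k‖))
            + ENNReal.ofReal (K * (ε / (2 * (K + 1)) * ‖s k‖)) := by
          rw [hS, ← Lp.enorm_def, ENNReal.ofReal_mul hη0.le, ENNReal.ofReal_mul hK,
            Real.enorm_of_nonneg hη0.le, Real.enorm_of_nonneg hK, ← ofReal_norm]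
          gcongr
          exact (s k).norm_size_le
      _ ≤ ENNReal.ofReal (ε * ‖s k‖) := by
          rw [← ENNReal.ofReal_add (by positivity) (by positivity)]
          refine ENNReal.ofReal_le_ofReal ?_
          have e1 : η * ((n + 1) * ‖s k‖) = ε / 2 * ‖s k‖ := by
            rw [hη]; field_simp
          have e2 : K * (ε / (2 * (K + 1)) * ‖s k‖) ≤ ε / 2 * ‖s k‖ := by
            rw [← mul_assoc]
            refine mul_le_mul_of_nonneg_right ?_ (norm_nonneg _)
            rw [mul_div_assoc', div_le_div_iff₀ (by positivity) (by positivity)]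
            nlinarith
          linarith
  rw [← ofReal_norm] at h2
  exact (ENNReal.ofReal_le_ofReal_iff (by positivity)).1 h2

end H2

/-! ### The operators -/

namespace H2

variable {n : ℕ} {Ω : Set (EuclideanSpace ℝ (Fin n))}

theorem coeFn_add_val (u w : H2 Ω) :
    (u + w).val =ᵐ[volume.restrict Ω] fun x => u.val x + w.val x := Lp.coeFn_add _ _

theorem coeFn_add_grad (u w : H2 Ω) (i : Fin n) :
    (u + w).grad i =ᵐ[volume.restrict Ω] fun x => u.grad i x + w.grad i x := Lp.coeFn_add _ _

/-- A linear combination of derivatives with bounded coefficients. -/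
theorem exists_clm_sum {ι : Type*} [Fintype ι] {φ : ι → EuclideanSpace ℝ (Fin n) → ℝ}
    (hφ : ∀ i, AEMeasurable (φ i) (volume.restrict Ω))
    (hb : ∀ i, ∃ K, ∀ᵐ x ∂volume.restrict Ω, |φ i x| ≤ K) (k : ι → JetIndex n) :
    ∃ T : H2 Ω →L[ℝ] L2 Ω, ∀ w : H2 Ω,
      T w =ᵐ[volume.restrict Ω] fun x => ∑ i, φ i x * (w : Jet Ω) (k i) x := by
  choose K hK using hb
  choose T hT using fun i => exists_clm_mul (hφ i) (hK i)
  refine ⟨∑ i, (T i).comp (derivL (k i)), fun w => ?_⟩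
  have h1 : (∑ i, (T i).comp (derivL (k i))) w = ∑ i, T i ((w : Jet Ω) (k i)) := by
    rw [_root_.sum_apply]
    rfl
  rw [h1]
  filter_upwards [Lp.coeFn_finsetSum Finset.univ fun i => T i ((w : Jet Ω) (k i)),
    ae_all_iff.2 fun i => hT i ((w : Jet Ω) (k i))] with x hx hx'
  rw [hx]
  simp only [Finset.sum_apply, hx']

end H2

namespace HJBIData

section operators

variable {n : ℕ} {Ω : Set (EuclideanSpace ℝ (Fin n))}

/-- Pointwise form of the remainder of the generalised linearisation. -/
theorem ae_remainder_eq {A B : Type*} {P : HJBIData n A B}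
    [MeasurableSpace A] [MeasurableSpace B] (hΩ : MeasurableSet Ω)
    {L : H2 Ω →L[ℝ] L2 Ω}
    (hL : ∀ w : H2 Ω, L w =ᵐ[volume.restrict Ω] fun x => ∑ i, ∑ j, P.a i j x * w.hess i j x)
    {N : H2 Ω → L2 Ω} (hN : ∀ u, N u =ᵐ[volume.restrict Ω] fun x =>
      P.hamiltonian x (u.val x) fun i => u.grad i x) {u s : H2 Ω} {M : H2 Ω →L[ℝ] L2 Ω}
    (hM : M ∈ P.jointDifferential (u + s)) :
    ∀ᵐ x ∂volume.restrict Ω, ∃ α β,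
      P.IsArgmax x (u.val x + s.val x) ((fun i => u.grad i x) + fun i => s.grad i x) α ∧
      P.IsArgmin x (u.val x + s.val x) ((fun i => u.grad i x) + fun i => s.grad i x) α β ∧
      ((-L (u + s) + N (u + s)) - (-L u + N u) - M s : L2 Ω) x
        = P.hamiltonian x (u.val x + s.val x) ((fun i => u.grad i x) + fun i => s.grad i x)
          - P.hamiltonian x (u.val x) (fun i => u.grad i x)
          - ((∑ i, P.b i x α β * s.grad i x) + P.c x α β * s.val x) := by
  obtain ⟨v, p, α, β, hr, hj, hc⟩ := hM
  -- Linearity cancels the second-order terms: `M s + L s` is only the first-order part of `M`.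
  have e : (-L (u + s) + N (u + s)) - (-L u + N u) - M s = N (u + s) - N u - (M s + L s) := by
    rw [map_add]
    abel
  rw [e]
  filter_upwards [ae_restrict_mem hΩ, hr.1, ae_all_iff.2 hr.2, hj.isArgmax, hc s, hL s,
    hN (u + s), hN u, Lp.coeFn_sub (N (u + s) - N u) (M s + L s), Lp.coeFn_sub (N (u + s)) (N u),
    Lp.coeFn_add (M s) (L s), H2.coeFn_add_val u s, ae_all_iff.2 fun i => H2.coeFn_add_grad u s i]
    with x hxΩ h1 h2 h3 h4 h5 h6 h7 h8 h9 h10 h11 h12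
  have hp : p x = (fun i => u.grad i x) + fun i => s.grad i x := by
    funext i
    rw [h2 i, h12 i]
    rfl
  have hp' : (fun i => (u + s).grad i x) = (fun i => u.grad i x) + fun i => s.grad i x := by
    funext i
    exact h12 i
  rw [h1, h11, hp] at h3
  have h13 := hj.isArgmin x hxΩ (α x)
  rw [h1, h11, hp] at h13
  refine ⟨α x, β x (α x), h3, h13, ?_⟩
  rw [h8, Pi.sub_apply, h9, Pi.sub_apply, h10, Pi.add_apply, h4, h5, h6, h7, h11, hp']
  ring

variable {A B : Type*} [TopologicalSpace B] {P : HJBIData n A B}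

theorem IsAdmissible.exists_secondOrder (hΩ : IsC11Domain Ω) (hP : P.IsAdmissible Ω) :
    ∃ L : H2 Ω →L[ℝ] L2 Ω, ∀ w : H2 Ω,
      L w =ᵐ[volume.restrict Ω] fun x => ∑ i, ∑ j, P.a i j x * w.hess i j x := by
  obtain ⟨T, hT⟩ := H2.exists_clm_sum (Ω := Ω) (φ := fun q : Fin n × Fin n => P.a q.1 q.2)
    (fun q => ((hP.a_continuous q.1 q.2).mono subset_closure).aemeasurable hΩ.isOpen.measurableSet)
    (fun q => by
      obtain ⟨K, hK⟩ := hΩ.isBounded.isCompact_closure.exists_bound_of_continuousOn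
        (hP.a_continuous q.1 q.2)
      refine ⟨K, ?_⟩
      filter_upwards [ae_restrict_mem hΩ.isOpen.measurableSet] with x hx
      exact hK x (subset_closure hx))
    fun q => .inr (.inr q)
  refine ⟨T, fun w => ?_⟩
  filter_upwards [hT w] with x hx
  rw [hx, Fintype.sum_prod_type]
  rfl

theorem IsAdmissible.exists_isControlledOperator [CompactSpace B]
    [TopologicalSpace.MetrizableSpace B] [MeasurableSpace B] [BorelSpace B] [Finite A]
    [MeasurableSpace A] [DiscreteMeasurableSpace A] (hΩ : IsC11Domain Ω) (hP : P.IsAdmissible Ω)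
    {α : EuclideanSpace ℝ (Fin n) → A} {β : EuclideanSpace ℝ (Fin n) → B}
    (hα : NullMeasurable α (volume.restrict Ω)) (hβ : NullMeasurable β (volume.restrict Ω)) :
    ∃ M : H2 Ω →L[ℝ] L2 Ω, P.IsControlledOperator α β M := by
  have haem : ∀ {φ : EuclideanSpace ℝ (Fin n) → A → B → ℝ}, IsAdmissibleCoeff Ω φ →
      AEMeasurable (fun x => φ x (α x) (β x)) (volume.restrict Ω) ∧
      ∃ K, ∀ᵐ x ∂volume.restrict Ω, |φ x (α x) (β x)| ≤ K := by
    intro φ hφ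
    obtain ⟨K, hK⟩ := hφ.bounded
    exact ⟨(hφ.nullMeasurable_comp hΩ.isOpen hα hβ).aemeasurable, K, hK.mono fun x hx => hx _ _⟩
  obtain ⟨L, hL⟩ := hP.exists_secondOrder hΩ
  obtain ⟨T, hT⟩ := H2.exists_clm_sum (fun i => (haem (hP.b_coeff i)).1)
    (fun i => (haem (hP.b_coeff i)).2) fun i => .inr (.inl i)
  obtain ⟨S, hS⟩ := H2.exists_clm_sum (fun _ : Unit => (haem hP.c_coeff).1)
    (fun _ => (haem hP.c_coeff).2) fun _ => .inl ()
  refine ⟨-L + T + S, fun w => ?_⟩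
  filter_upwards [hL w, hT w, hS w, Lp.coeFn_add (-(L w) + T w) (S w),
    Lp.coeFn_add (-(L w)) (T w), Lp.coeFn_neg (L w)] with x h1 h2 h3 h4 h5 h6
  simp only [_root_.add_apply, _root_.neg_apply, h4, h5, h6,
    Pi.add_apply, Pi.neg_apply, h1, h2, h3, Finset.univ_unique, Finset.sum_singleton]
  rfl

variable [CompactSpace B] [Nonempty B] [TopologicalSpace.MetrizableSpace B] [Finite A] [Nonempty A]

theorem IsAdmissible.memLp_hamiltonian (hΩ : IsC11Domain Ω) (hP : P.IsAdmissible Ω) (u : H2 Ω) :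
    MemLp (fun x => P.hamiltonian x (u.val x) fun i => u.grad i x) 2 (volume.restrict Ω) := by
  have := hΩ.isFiniteMeasure
  obtain ⟨K, -, hK⟩ := hP.exists_boundedAt
  have hm : NullMeasurable (fun x => P.hamiltonian x (u.val x) fun i => u.grad i x)
      (volume.restrict Ω) :=
    hP.nullMeasurable_hamiltonian hΩ.isOpen (Lp.stronglyMeasurable _).measurable.nullMeasurable
      fun i => (Lp.stronglyMeasurable _).measurable.nullMeasurable
  refine MemLp.mono' (((Lp.memLp u.size).const_mul K).add (memLp_const K))
    hm.aemeasurable.aestronglyMeasurable ?_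
  filter_upwards [hK, u.coeFn_size, ae_restrict_mem hΩ.isOpen.measurableSet] with x hx hx' hxΩ
  simp only [Pi.add_apply, hx']
  exact hx.abs_hamiltonian_le (hP.continuousCoeffAt hxΩ) _ _

/-- The Nemytskii operator `u ↦ G(·, u, ∇u)` is Lipschitz continuous. -/
theorem IsAdmissible.exists_nemytskii (hΩ : IsC11Domain Ω) (hP : P.IsAdmissible Ω) :
    ∃ N : H2 Ω → L2 Ω, Continuous N ∧ ∀ u, N u =ᵐ[volume.restrict Ω] fun x =>
      P.hamiltonian x (u.val x) fun i => u.grad i x := by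
  refine ⟨fun u => (hP.memLp_hamiltonian hΩ u).toLp _, ?_, fun u => MemLp.coeFn_toLp _⟩
  obtain ⟨K, hK0, hK⟩ := hP.exists_boundedAt
  refine (LipschitzWith.of_dist_le_mul (K := (⟨K * (n + 1), by positivity⟩ : NNReal))
    fun u v => ?_).continuous
  obtain ⟨w, rfl⟩ : ∃ w, u = v + w := ⟨u - v, by abel⟩
  simp only [dist_eq_norm, add_sub_cancel_left]
  have h : ‖(hP.memLp_hamiltonian hΩ (v + w)).toLp _ - (hP.memLp_hamiltonian hΩ v).toLp _‖
      ≤ K * ‖w.size‖ := by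
    refine Lp.norm_le_mul_norm_of_ae_le_mul ?_
    filter_upwards [hK, w.coeFn_size, ae_restrict_mem hΩ.isOpen.measurableSet,
      Lp.coeFn_sub ((hP.memLp_hamiltonian hΩ (v + w)).toLp _) ((hP.memLp_hamiltonian hΩ v).toLp _),
      (hP.memLp_hamiltonian hΩ (v + w)).coeFn_toLp, (hP.memLp_hamiltonian hΩ v).coeFn_toLp,
      H2.coeFn_add_val v w, ae_all_iff.2 fun i => H2.coeFn_add_grad v w i]
      with x hx h1 hxΩ h2 h3 h4 h5 h6
    rw [h2, Pi.sub_apply, h3, h4, h5, h1]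
    simp only [h6]
    refine (hx.abs_hamiltonian_sub_le (hP.continuousCoeffAt hxΩ) (v.val x) (fun i => v.grad i x)
      (w.val x) fun i => w.grad i x).trans ?_
    exact mul_le_mul_of_nonneg_left (le_abs_self _) hK0
  calc _ ≤ K * ‖w.size‖ := h
    _ ≤ K * ((n + 1) * ‖w‖) := mul_le_mul_of_nonneg_left w.norm_size_le hK0
    _ = K * (n + 1) * ‖w‖ := by ring

/-- Argued by contradiction along a sequence of increments, with one violating operator chosen for
each. Thus no measurability of a supremum of remainders is needed, and only countably many a.e.
statements are combined. -/
theorem IsAdmissible.isSemismoothOn [MeasurableSpace B] [BorelSpace B] [MeasurableSpace A]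
    [DiscreteMeasurableSpace A] (hΩ : IsC11Domain Ω) (hP : P.IsAdmissible Ω)
    {L : H2 Ω →L[ℝ] L2 Ω}
    (hL : ∀ w : H2 Ω, L w =ᵐ[volume.restrict Ω] fun x => ∑ i, ∑ j, P.a i j x * w.hess i j x)
    {N : H2 Ω → L2 Ω} (hNc : Continuous N) (hN : ∀ u, N u =ᵐ[volume.restrict Ω] fun x =>
      P.hamiltonian x (u.val x) fun i => u.grad i x) :
    IsSemismoothOn (fun u => -L u + N u) P.jointDifferential univ where
  isOpen := isOpen_univ
  nonempty u _ := by
    have hr : u.IsRepresentative u.val fun x i => u.grad i x :=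
      ⟨EventuallyEq.rfl, fun i => EventuallyEq.rfl⟩
    obtain ⟨α, β, hj⟩ := hP.exists_isJointFeedback hΩ.isOpen hr
    obtain ⟨M, hM⟩ := hP.exists_isControlledOperator hΩ hj.measurable_max
      (hj.nullMeasurable_comp hj.measurable_max)
    exact ⟨M, _, _, α, β, hr, hj, hM⟩
  continuous_near u _ := Eventually.of_forall fun w =>
    (L.continuous.neg.add hNc).continuousAt
  sup_isLittleO u _ ε hε := by
    by_contra hcon
    obtain ⟨s, hs, hbad⟩ := exists_seq_forall_of_frequently (not_eventually.1 hcon)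
    push Not at hbad
    choose M hM hbad using hbad
    obtain ⟨K, hK0, hK⟩ := hP.exists_boundedAt
    have hpt := fun k => ae_remainder_eq hΩ.isOpen.measurableSet hL hN (hM k)
    obtain ⟨k, hk⟩ := H2.exists_norm_le_of_pointwise hΩ hs
      (R := fun k => (-L (u + s k) + N (u + s k)) - (-L u + N u) - M k (s k)) (K := 2 * K)
      (by positivity) (fun k => by
        filter_upwards [hpt k, hK, (s k).coeFn_size, ae_restrict_mem hΩ.isOpen.measurableSet]
          with x hx hxK hxs hxΩ
        obtain ⟨α, β, -, -, hR⟩ := hx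
        rw [hR, hxs]
        exact hxK.abs_hamiltonian_remainder_le (hP.continuousCoeffAt hxΩ) _ _ _ _ α β)
      (by
        filter_upwards [ae_all_iff.2 hpt, hK, ae_all_iff.2 fun k => (s k).coeFn_size,
          ae_restrict_mem hΩ.isOpen.measurableSet] with x hx hxK hxs hxΩ η hη
        -- This radius depends on `x` and `η` but on no control, hence serves all `k`
        -- simultaneously.
        obtain ⟨δ, hδ, h⟩ := hxK.exists_abs_ell_sub_hamiltonian_le (hP.continuousCoeffAt hxΩ)
          (u.val x) (fun i => u.grad i x) hη
        refine ⟨δ, hδ, fun k hk => ?_⟩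
        obtain ⟨α, β, hα, hβ, hR⟩ := hx k
        rw [hxs k] at hk ⊢
        rw [hR, hamiltonian_remainder_eq hα hβ]
        exact h _ _ hk α β hα hβ) hε
    exact absurd hk (not_le.2 (hbad k))

end operators

end HJBIData

theorem mainTheorem5 {n : ℕ} (hn : 1 ≤ n) {Ω : Set (EuclideanSpace ℝ (Fin n))}
    (hΩ : IsC11Domain Ω)
    {A : Type*} [Finite A] [Nonempty A] [MeasurableSpace A] [DiscreteMeasurableSpace A]
    {B : Type*} [MetricSpace B] [CompactSpace B] [Nonempty B] [MeasurableSpace B] [BorelSpace B]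
    (P : HJBIData n A B) (hP : P.IsAdmissible Ω) :
    -- each pair of measurable controls defines a bounded operator from `H²(Ω)` to `L²(Ω)`
    (∀ (α : EuclideanSpace ℝ (Fin n) → A) (β : EuclideanSpace ℝ (Fin n) → B),
      NullMeasurable α (volume.restrict Ω) → NullMeasurable β (volume.restrict Ω) →
      ∃ M : H2 Ω →L[ℝ] L2 Ω, P.IsControlledOperator α β M) ∧
    -- for all pointwise values of `u` and `∇u` there are controls of both kinds
    (∀ (u : H2 Ω) (v : EuclideanSpace ℝ (Fin n) → ℝ) (p : EuclideanSpace ℝ (Fin n) → Fin n → ℝ),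
      u.IsRepresentative v p →
      (∃ α β, P.IsJointFeedback Ω v p α β) ∧ ∃ α β, P.IsFeedback Ω v p α β) ∧
    -- the operator is well defined and semismooth with either generalized differential
    ∃ F : H2 Ω → L2 Ω, P.IsOperator F ∧
      IsSemismoothOn F P.jointDifferential univ ∧
      IsSemismoothOn F P.feedbackDifferential univ ∧
      ∀ u : H2 Ω, P.jointDifferential u = P.feedbackDifferential u := by
  have heq : ∀ u : H2 Ω, P.jointDifferential u = P.feedbackDifferential u :=
    P.jointDifferential_eq_feedbackDifferential hΩ.isOpen hP
  refine ⟨fun α β hα hβ => hP.exists_isControlledOperator hΩ hα hβ, fun u v p hr => ?_, ?_⟩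
  · obtain ⟨α, β, hj⟩ := hP.exists_isJointFeedback hΩ.isOpen hr
    obtain ⟨α', -, hf⟩ := hj.exists_isFeedback hΩ.isOpen hP hr
    exact ⟨⟨α, β, hj⟩, α', _, hf⟩
  · obtain ⟨L, hL⟩ := hP.exists_secondOrder hΩ
    obtain ⟨N, hNc, hN⟩ := hP.exists_nemytskii hΩ
    have hs := hP.isSemismoothOn hΩ hL hNc hN
    refine ⟨fun u => -L u + N u, fun u => ?_, hs, funext heq ▸ hs, heq⟩
    filter_upwards [hL u, hN u, Lp.coeFn_add (-(L u)) (N u), Lp.coeFn_neg (L u)]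
      with x h1 h2 h3 h4
    rw [h3, Pi.add_apply, h4, Pi.neg_apply, h1, h2]
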